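/- **Schemes.** An access control scheme consists of a set of states, a set of commands (a command $c$ with a parameter space and an effect $\gamma\mapsto c(p)(\gamma)$) and a set of queries (each with a parameter space and a truth value for every state and parameter). $\gamma\Mapsto\gamma'$ means that $\gamma'$ arises from $\gamma$ by finitely many (possibly zero) commands. An auxiliary machine for a scheme $S$ has its own states, and commands and queries over pairs (state of $S$, auxiliary state); its commands change only the auxiliary component. The augmented scheme $S\circ A$ has as states the pairs and as commands and queries those of $S$ and of $A$. An implementation $\sigma$ of $W$ in $S$ maps states to states, commands to strings of parameterized commands (which may depend on the current state of $S$), and queries with their parameters to queries with parameters. Write $\gamma\equiv_\sigma\delta$ if every query of $W$ with every parameter has the same value at $\gamma$ as its image has at $\delta$. $\sigma$ is *state-matching* if for every state $\gamma$ of $W$: (1) for each $\gamma_1$ with $\gamma\Mapsto\gamma_1$ there is $\delta_1$ with $\sigma(\gamma)\Mapsto\delta_1$ and $\gamma_1\equiv_\sigma\delta_1$; (2) for each $\delta_1$ with $\sigma(\gamma)\Mapsto\delta_1$ there is $\gamma_1$ with $\gamma\Mapsto\gamma_1$ and $\gamma_1\equiv_\sigma\delta_1$. **GMS.** Fix a finite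 set $U$ of users, an infinite set $\mathcal G$ of potential groups and a set $M$ of messages. Timestamps are $T=\mathbb N\cup\{\infty\}$. A state consists of a current time $T_c\in\mathbb N$ and finite sets $G\subseteq\mathcal G$, $O,A\subseteq U\times G$ (ownership, administration), $R\subseteq U\times G\times T\times T$ (membership records), $TX\subseteq G\times M\times T$ (transcript). Commands (without effect if the condition fails): - CreateGroup$(u,g)$: add $g$ to $G$, $(u,g)$ to $O$ and $A$, $(u,g,0,\infty)$ to $R$. - GrantAdmin$(o,u,g)$: if $(o,g)\in O$, add $(u,g)$ to $A$. RevokeAdmin$(o,u,g)$: if $(o,g)\in O$ or $o=u$, remove $(u,g)$ from $A$. - SAddMember$(a,u,g)$: if $(a,g)\in A$, add $(u,g,T_c,\infty)$ to $R$ and increment $T_c$. LAddMember$(a,u,g)$: if $(a,g)\in A$, add $(u,g,0,\infty)$ to $R$. - SRemoveMember$(a,u,g)$: if $(a,g)\in A$ or $a=u$, remove all $(u,g,t,t')$ from $R$. LRemoveMember$(a,u,g)$: if $(a,g)\in A$, replace each $(u,g,t,\infty)\in R$ by $(u,g,t,T_c)$. - Post$(u,g,m)$: if $(u,g,t,\infty)\in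 R$ for some $t$, add $(g,m,T_c)$ to $TX$ and increment $T_c$. The only query is Access$(u,m)$: there are $g\in G$ and $t_l\le t\le t_u$ in $T$ with $(u,g,t_l,t_u)\in R$, $(g,m,t)\in TX$. **SD3-GM.** A state is a set $P$ of Datalog sentences; a ground atom evaluates to true if it is derivable from $P$, with LESSEQ built in on timestamps. Commands have the names and parameters of those of GMS and do the same with the facts OWN$(u,g)$, ADMIN$(u,g)$, MEMBER$(u,g,t,t')$, POST$(g,m,t)$, TIME$(T_c)$ in the roles of $O,A,R,TX,T_c$; their conditions are evaluated in $P$, that of Post as CURRMEMBER$(u,g)$. Access$(u,m)$ evaluates ACCESS$(u,m)$. The implementation $\sigma^S$ maps a GMS state to the facts for $O,A,R,TX,T_c$ together with the rules ACCESS$(U,M)$ :- MEMBER$(U,G,T_1,T_2)$, POST$(G,M,T)$, LESSEQ$(T_1,T)$, LESSEQ$(T,T_2)$ and CURRMEMBER$(U,G)$ :- MEMBER$(U,G,T,\infty)$; commands and queries are mapped identically. **RBAC∘U.** Let $\mathcal P$ be a set of permissions into which $M$ is embedded and $\mathcal R$ a set of role names containing distinct names admin, $r^m$ ($m\in M$),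 $m^g,o^g,a^g$ ($g\in\mathcal G$). An RBAC state consists of finite sets $R\subseteq\mathcal R$, $UA\subseteq U\times\mathcal R$, $PA\subseteq\mathcal P\times\mathcal R$. Commands, each effective only if the acting user $a$ has $(a,\text{admin})\in UA$: AddRole$(a,r)$, DeleteRole$(a,r)$ (change $R$), AssignUser$(a,u,r)$, DeassignUser$(a,u,r)$ (change $UA$), GrantPermission$(a,p,r)$, RevokePermission$(a,p,r)$ (change $PA$). Queries: Access$(u,p)$: $(u,r)\in UA$ and $(p,r)\in PA$ for some $r\in R$; Assigned$(u,r)$: $(u,r)\in UA$. The auxiliary machine U stores finite sets $G$ of groups and $GM\subseteq\mathcal G\times\mathcal P$ and has the commands CreateGroup$(u,g)$ (adds $g$ to $G$) and AssociateWithGroup$(u,g,p)$ (adds $(g,p)$ to $GM$), both effective only if $(u,\text{admin})\in UA$, and no queries. The implementation $\sigma^R$ maps a GMS state to: $R$ consisting of admin, $r^m$ for every posted $m$, and $m^g,o^g,a^g$ for every group $g$; $PA=\{(m,r^m):m\text{ posted}\}$; $UA$ assigning every user to admin, $u$ to $r^m$ iff $u$ has access to $m$, $u$ to $m^g$ iff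 $(u,g,t,\infty)$ is a record for some $t$, and $u$ to $o^g$, $a^g$ iff $u$ owns, administers $g$; and U storing the groups and the pairs $(g,m)$ with $m$ posted to $g$. Access$(u,m)$ is mapped to Access$(u,m)$. Commands: CreateGroup$(u,g)$ is mapped to CreateGroup$(u,g)$ and then AddRole$(u,r)$, AssignUser$(u,u,r)$ for $r=m^g,o^g,a^g$; GrantAdmin, RevokeAdmin$(u,u_2,g)$ to AssignUser, DeassignUser$(u,u_2,a^g)$; SAddMember, LRemoveMember$(u,u_2,g)$ to AssignUser, DeassignUser$(u,u_2,m^g)$; LAddMember, SRemoveMember$(u,u_2,g)$ to the same, followed by AssignUser, respectively DeassignUser$(u,u_2,r^m)$ for each $m$ with $(g,m)\in GM$; Post$(u,g,m)$ to AssociateWithGroup$(u,g,m)$ followed by AssignUser$(u,u_2,r^m)$ for each $u_2$ with $(u_2,m^g)\in UA$. **DAC∘V.** Subjects are $U$; $\mathcal O$ is a set of objects into which $M$ is embedded; rights are $I=\{\mathrm r,\mathrm{own}\}$; a state is an access matrix $\mathcal M:U\times\mathcal O\to2^I$. Commands Grant$(s,t,o,i)$, Revoke$(s,t,o,i)$ add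 $i$ to, respectively remove $i$ from, $\mathcal M(t,o)$ if $\mathrm{own}\in\mathcal M(s,o)$ and $i\ne\mathrm{own}$. The query Access$(s,o,i)$ asks whether $i\in\mathcal M(s,o)$. The auxiliary machine V stores finite sets $G$ of groups, $GM\subseteq\mathcal G\times\mathcal O$, and $W,A,B\subseteq U\times\mathcal G$ (ownership, administration, membership), has no queries, and has the commands CreateGroup$(s,g)$ (adds $g$ to $G$ and $(s,g)$ to $W,A,B$), AssociateWithGroup$(s,g,o)$ (if $(s,g)\in B$, adds $(g,o)$ to $GM$), GrantAdmin / RevokeAdmin$(s,t,g)$ (if $(s,g)\in W$, for RevokeAdmin also if $s=t$, adds / removes $(t,g)$ in $A$), GrantMember / RevokeMember$(s,t,g)$ (if $(s,g)\in A$, adds / removes $(t,g)$ in $B$). The implementation $\sigma^D$ maps a GMS state to the matrix in which every subject owns every object and $\mathrm r\in\mathcal M(u,o)$ iff $o$ is the object of a message to which $u$ has access, with V storing the groups, the pairs $(g,m)$ with $m$ posted to $g$, ownership, administration, and current membership. Access$(u,m)$ is mapped to Access$(u,m,\mathrm r)$. CreateGroup, GrantAdmin and RevokeAdmin are mapped to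 the commands of V of the same name; SAddMember, LRemoveMember$(u,u_2,g)$ to GrantMember, RevokeMember$(u,u_2,g)$; LAddMember, SRemoveMember$(u,u_2,g)$ to the same, followed by Grant, respectively Revoke$(u,u_2,m,\mathrm r)$ for each $m$ with $(g,m)\in GM$; Post$(u,g,m)$ to AssociateWithGroup$(u,g,m)$ followed by Grant$(u,u_2,m,\mathrm r)$ for each $u_2$ with $(u_2,g)\in B$. **Theorem.** There is a state-matching implementation of GMS in each of SD3-GM, RBAC∘U and DAC∘V. More precisely: $\sigma^S$ is state-matching and is a lock-step bisimulation, that is, $\sigma^S(c(p)(\gamma))=c(p)(\sigma^S(\gamma))$ for every state $\gamma$ of GMS, command $c$ and parameter $p$, and $\gamma\equiv_{\sigma^S}\sigma^S(\gamma)$; $\sigma^R$ is state-matching; and $\sigma^D$ is state-matching. -/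

import Mathlib

universe u

namespace ACS

noncomputable section

open scoped Classical

/-! ## Access control schemes, auxiliary machines, implementations -/

/-- An access control scheme: states, parameterized commands and parameterized queries.
`CmdParam c` is the (product of the) parameter spaces of the command `c`, and similarly for
queries. -/
structure Scheme where
  State : Type u
  Cmd : Type
  CmdParam : Cmd → Type u
  exec : (c : Cmd) → State → CmdParam c → State
  Query : Type
  QueryParam : Query → Type u
  entails : (q : Query) → State → QueryParam q → Prop

/-- One command, executed with some parameters, leads from `γ` to `γ'`. -/
def Scheme.Step (S : Scheme.{u}) (γ γ' : S.State) : Prop :=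
  ∃ (c : S.Cmd) (p : S.CmdParam c), S.exec c γ p = γ'

/-- `γ'` is reachable from `γ` by a finite (possibly empty) sequence of commands. -/
def Scheme.Reach (S : Scheme.{u}) : S.State → S.State → Prop :=
  Relation.ReflTransGen S.Step

/-- An auxiliary machine for the scheme `S`: its commands and queries may inspect the state of
`S`, but its commands return a new auxiliary state only, so they cannot alter the state of `S`. -/
structure AuxMachine (S : Scheme.{u}) where
  State : Type u
  Cmd : Type
  CmdParam : Cmd → Type u
  exec : (c : Cmd) → S.State → State → CmdParam c → State
  Query : Type
  QueryParam : Query → Type u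
  entails : (q : Query) → S.State → State → QueryParam q → Prop

/-- The augmented scheme `S ∘ A`: product of the states, union of the commands and queries. -/
def Scheme.augment (S : Scheme.{u}) (A : AuxMachine S) : Scheme.{u} where
  State := S.State × A.State
  Cmd := S.Cmd ⊕ A.Cmd
  CmdParam := Sum.elim S.CmdParam A.CmdParam
  exec := fun c => match c with
    | Sum.inl c => fun γ p => (S.exec c γ.1 p, γ.2)
    | Sum.inr c => fun γ p => (γ.1, A.exec c γ.1 γ.2 p)
  Query := S.Query ⊕ A.Query
  QueryParam := Sum.elim S.QueryParam A.QueryParam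
  entails := fun q => match q with
    | Sum.inl q => fun γ p => S.entails q γ.1 p
    | Sum.inr q => fun γ p => A.entails q γ.1 γ.2 p

/-- An implementation of the scheme `W` in the scheme `S`: a map of states, a map of commands to
strings of parameterized commands (which may depend on the current state of `S`), and a map of
queries together with the accompanying map of their parameters. -/
structure Implementation (W S : Scheme.{u}) where
  stateMap : W.State → S.State
  cmdMap : (c : W.Cmd) → W.CmdParam c → S.State → List ((d : S.Cmd) × S.CmdParam d)
  queryMap : W.Query → S.Query
  queryArg : (q : W.Query) → W.QueryParam q → S.QueryParam (queryMap q)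

/-- `γ` and `γ'` answer every query of `W`, for every parameterization, in the same way. -/
def Implementation.Equiv {W S : Scheme.{u}} (σ : Implementation W S)
    (γ : W.State) (γ' : S.State) : Prop :=
  ∀ (q : W.Query) (p : W.QueryParam q),
    W.entails q γ p ↔ S.entails (σ.queryMap q) γ' (σ.queryArg q p)

/-- State-matching implementations. -/
def Implementation.IsStateMatching {W S : Scheme.{u}} (σ : Implementation W S) : Prop :=
  ∀ γ : W.State,
    (∀ γ₁ : W.State, W.Reach γ γ₁ →
      ∃ δ₁ : S.State, S.Reach (σ.stateMap γ) δ₁ ∧ σ.Equiv γ₁ δ₁) ∧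
    (∀ δ₁ : S.State, S.Reach (σ.stateMap γ) δ₁ →
      ∃ γ₁ : W.State, W.Reach γ γ₁ ∧ σ.Equiv γ₁ δ₁)

/-! ## The abstract group messaging scheme GMS -/

/-- A state of GMS over the users `U`, the (potential) groups `G`, the messages `M` and the
timestamps `ℕ∞`. The users and messages are changed by no command and are the carrier types. -/
structure GMState (U G M : Type u) where
  groups : Finset G
  now : ℕ
  owner : Finset (U × G)
  admin : Finset (U × G)
  record : Finset (U × G × ℕ∞ × ℕ∞)
  transcript : Finset (G × M × ℕ∞)
  owner_sub : ∀ x ∈ owner, x.2 ∈ groups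
  admin_sub : ∀ x ∈ admin, x.2 ∈ groups
  record_sub : ∀ x ∈ record, x.2.1 ∈ groups
  transcript_sub : ∀ x ∈ transcript, x.1 ∈ groups

/-- The names of the commands of GMS. -/
inductive GMCmd
  | createGroup | grantAdmin | revokeAdmin | sAddMember | lAddMember
  | sRemoveMember | lRemoveMember | post

/-- The parameter spaces of the commands of GMS. -/
def GMCmd.Param (U G M : Type u) : GMCmd → Type u
  | .createGroup => U × G
  | .post => U × G × M
  | _ => U × U × G

namespace GMState

variable {U G M : Type u}

def createGroup (γ : GMState U G M) (v : U) (g : G) : GMState U G M where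
  groups := γ.groups ∪ {g}
  now := γ.now
  owner := γ.owner ∪ {(v, g)}
  admin := γ.admin ∪ {(v, g)}
  record := γ.record ∪ {(v, g, 0, ⊤)}
  transcript := γ.transcript
  owner_sub := by
    intro x hx
    rcases Finset.mem_union.1 hx with h | h
    · exact Finset.mem_union_left _ (γ.owner_sub x h)
    · rw [Finset.mem_singleton.1 h]; simp
  admin_sub := by
    intro x hx
    rcases Finset.mem_union.1 hx with h | h
    · exact Finset.mem_union_left _ (γ.admin_sub x h)
    · rw [Finset.mem_singleton.1 h]; simp
  record_sub := by
    intro x hx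
    rcases Finset.mem_union.1 hx with h | h
    · exact Finset.mem_union_left _ (γ.record_sub x h)
    · rw [Finset.mem_singleton.1 h]; simp
  transcript_sub := fun x hx => Finset.mem_union_left _ (γ.transcript_sub x hx)

def grantAdmin (γ : GMState U G M) (o v : U) (g : G) : GMState U G M :=
  if h : (o, g) ∈ γ.owner then
    { γ with
      admin := γ.admin ∪ {(v, g)}
      admin_sub := by
        intro x hx
        rcases Finset.mem_union.1 hx with h' | h'
        · exact γ.admin_sub x h'
        · rw [Finset.mem_singleton.1 h']; exact γ.owner_sub (o, g) h }
  else γ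

def revokeAdmin (γ : GMState U G M) (o v : U) (g : G) : GMState U G M :=
  if (o, g) ∈ γ.owner ∨ o = v then
    { γ with
      admin := γ.admin \ {(v, g)}
      admin_sub := fun x hx => γ.admin_sub x (Finset.mem_sdiff.1 hx).1 }
  else γ

def sAddMember (γ : GMState U G M) (a v : U) (g : G) : GMState U G M :=
  if h : (a, g) ∈ γ.admin then
    { γ with
      record := γ.record ∪ {(v, g, (γ.now : ℕ∞), ⊤)}
      now := γ.now + 1
      record_sub := by
        intro x hx
        rcases Finset.mem_union.1 hx with h' | h'
        · exact γ.record_sub x h'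
        · rw [Finset.mem_singleton.1 h']; exact γ.admin_sub (a, g) h }
  else γ

def lAddMember (γ : GMState U G M) (a v : U) (g : G) : GMState U G M :=
  if h : (a, g) ∈ γ.admin then
    { γ with
      record := γ.record ∪ {(v, g, 0, ⊤)}
      record_sub := by
        intro x hx
        rcases Finset.mem_union.1 hx with h' | h'
        · exact γ.record_sub x h'
        · rw [Finset.mem_singleton.1 h']; exact γ.admin_sub (a, g) h }
  else γ

/-- Remove all membership records of `v` in `g`. -/
def sRemoveMember (γ : GMState U G M) (a v : U) (g : G) : GMState U G M :=
  if (a, g) ∈ γ.admin ∨ a = v then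
    { γ with
      record := γ.record.filter fun x => ¬ (x.1 = v ∧ x.2.1 = g)
      record_sub := fun x hx => γ.record_sub x (Finset.mem_filter.1 hx).1 }
  else γ

/-- Replace every open record `(v, g, t, ∞)` by the closed record `(v, g, t, T_c)`. -/
def lRemoveMember (γ : GMState U G M) (a v : U) (g : G) : GMState U G M :=
  if h : (a, g) ∈ γ.admin then
    { γ with
      record :=
        (γ.record ∪
          (γ.record.filter fun x => x.1 = v ∧ x.2.1 = g ∧ x.2.2.2 = ⊤).image
            fun x => (v, g, x.2.2.1, (γ.now : ℕ∞))) \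
        (γ.record.filter fun x => x.1 = v ∧ x.2.1 = g ∧ x.2.2.2 = ⊤)
      record_sub := by
        intro x hx
        rcases Finset.mem_union.1 (Finset.mem_sdiff.1 hx).1 with h' | h'
        · exact γ.record_sub x h'
        · obtain ⟨y, -, rfl⟩ := Finset.mem_image.1 h'
          exact γ.admin_sub (a, g) h }
  else γ

def post (γ : GMState U G M) (v : U) (g : G) (m : M) : GMState U G M :=
  if h : ∃ t : ℕ∞, (v, g, t, ⊤) ∈ γ.record then
    { γ with
      transcript := γ.transcript ∪ {(g, m, (γ.now : ℕ∞))}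
      now := γ.now + 1
      transcript_sub := by
        intro x hx
        rcases Finset.mem_union.1 hx with h' | h'
        · exact γ.transcript_sub x h'
        · rw [Finset.mem_singleton.1 h']
          obtain ⟨t, ht⟩ := h
          exact γ.record_sub (v, g, t, ⊤) ht }
  else γ

def Access (γ : GMState U G M) (v : U) (m : M) : Prop :=
  ∃ g ∈ γ.groups, ∃ tl t tu : ℕ∞,
    (v, g, tl, tu) ∈ γ.record ∧ (g, m, t) ∈ γ.transcript ∧ tl ≤ t ∧ t ≤ tu

end GMState

/-- The abstract group messaging scheme. Its only query is `Access(v, m)`. -/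
def GMS (U G M : Type u) : Scheme.{u} where
  State := GMState U G M
  Cmd := GMCmd
  CmdParam := GMCmd.Param U G M
  exec := fun c => match c with
    | .createGroup => fun γ (v, g) => γ.createGroup v g
    | .grantAdmin => fun γ (o, v, g) => γ.grantAdmin o v g
    | .revokeAdmin => fun γ (o, v, g) => γ.revokeAdmin o v g
    | .sAddMember => fun γ (a, v, g) => γ.sAddMember a v g
    | .lAddMember => fun γ (a, v, g) => γ.lAddMember a v g
    | .sRemoveMember => fun γ (a, v, g) => γ.sRemoveMember a v g
    | .lRemoveMember => fun γ (a, v, g) => γ.lRemoveMember a v g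
    | .post => fun γ (v, g, m) => γ.post v g m
  Query := Unit
  QueryParam := fun _ => U × M
  entails := fun _ γ (v, m) => γ.Access v m

/-! ## SD3-GM

Policies are sets of Datalog sentences over the predicates of SD3-GM, evaluated by
derivability, with an inherent predicate `LESSEQ` on timestamps. -/

inductive SD3Pred
  | own | admin | member | post | time | access | currMember | lesseq

inductive SD3Const (U G M : Type u)
  | user (v : U) | group (g : G) | msg (m : M) | time (t : ℕ∞)

inductive SD3Term (U G M : Type u)
  | var (n : ℕ) | const (c : SD3Const U G M)

structure SD3Atom (U G M : Type u) where
  pred : SD3Pred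
  args : List (SD3Term U G M)

/-- A policy sentence `head :- body`. -/
structure SD3Sentence (U G M : Type u) where
  head : SD3Atom U G M
  body : List (SD3Atom U G M)

/-- The instance of a term under an assignment of constants to the variables. -/
def SD3Term.inst {U G M : Type u} (v : ℕ → SD3Const U G M) : SD3Term U G M → SD3Const U G M
  | .var n => v n
  | .const c => c

/-- `SD3Eval P p l`: the ground atom `p(l)` is derivable from the policy `P`. -/
inductive SD3Eval {U G M : Type u} (P : Set (SD3Sentence U G M)) :
    SD3Pred → List (SD3Const U G M) → Prop
  | lesseq (t₁ t₂ : ℕ∞) (h : t₁ ≤ t₂) : SD3Eval P .lesseq [.time t₁, .time t₂]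
  | rule (s : SD3Sentence U G M) (hs : s ∈ P) (v : ℕ → SD3Const U G M)
      (h : ∀ a ∈ s.body, SD3Eval P a.pred (a.args.map (SD3Term.inst v))) :
      SD3Eval P s.head.pred (s.head.args.map (SD3Term.inst v))

namespace SD3

variable {U G M : Type u}

/-- The bodiless ground sentence `p(l)`. -/
def fact (p : SD3Pred) (l : List (SD3Const U G M)) : SD3Sentence U G M :=
  ⟨⟨p, l.map .const⟩, []⟩

def ownS (v : U) (g : G) : SD3Sentence U G M := fact .own [.user v, .group g]

def adminS (v : U) (g : G) : SD3Sentence U G M := fact .admin [.user v, .group g]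

def memberS (v : U) (g : G) (t₁ t₂ : ℕ∞) : SD3Sentence U G M :=
  fact .member [.user v, .group g, .time t₁, .time t₂]

def postS (g : G) (m : M) (t : ℕ∞) : SD3Sentence U G M :=
  fact .post [.group g, .msg m, .time t]

def timeS (t : ℕ∞) : SD3Sentence U G M := fact .time [.time t]

/-- `ACCESS(U, M) :- MEMBER(U, G, T₁, T₂), POST(G, M, T), LESSEQ(T₁, T), LESSEQ(T, T₂)`, with
the variables `U, M, G, T₁, T₂, T` numbered `0, …, 5`. -/
def accessRule : SD3Sentence U G M where
  head := ⟨.access, [.var 0, .var 1]⟩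
  body := [⟨.member, [.var 0, .var 2, .var 3, .var 4]⟩,
           ⟨.post, [.var 2, .var 1, .var 5]⟩,
           ⟨.lesseq, [.var 3, .var 5]⟩,
           ⟨.lesseq, [.var 5, .var 4]⟩]

/-- `CURRMEMBER(U, G) :- MEMBER(U, G, T, ∞)`, with `U, G, T` numbered `0, 1, 2`. -/
def currMemberRule : SD3Sentence U G M where
  head := ⟨.currMember, [.var 0, .var 1]⟩
  body := [⟨.member, [.var 0, .var 1, .var 2, .const (.time ⊤)]⟩]

/-- The policy `P ∪ {TIME(T_c + 1)} - {TIME(T_c)}`, where `T_c` is the time recorded in `P`. -/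
def tick (P : Set (SD3Sentence U G M)) : Set (SD3Sentence U G M) :=
  (P ∪ {s | ∃ t : ℕ∞, timeS t ∈ P ∧ s = timeS (t + 1)}) \ {s | ∃ t : ℕ∞, s = timeS t ∧ s ∈ P}

def createGroup (P : Set (SD3Sentence U G M)) (v : U) (g : G) : Set (SD3Sentence U G M) :=
  P ∪ {ownS v g, adminS v g, memberS v g 0 ⊤}

def grantAdmin (P : Set (SD3Sentence U G M)) (o v : U) (g : G) : Set (SD3Sentence U G M) :=
  if SD3Eval P .own [.user o, .group g] then P ∪ {adminS v g} else P

def revokeAdmin (P : Set (SD3Sentence U G M)) (o v : U) (g : G) : Set (SD3Sentence U G M) :=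
  if SD3Eval P .own [.user o, .group g] ∨ o = v then P \ {adminS v g} else P

def sAddMember (P : Set (SD3Sentence U G M)) (a v : U) (g : G) : Set (SD3Sentence U G M) :=
  if SD3Eval P .admin [.user a, .group g] then
    tick (P ∪ {s | ∃ t : ℕ∞, timeS t ∈ P ∧ s = memberS v g t ⊤})
  else P

def lAddMember (P : Set (SD3Sentence U G M)) (a v : U) (g : G) : Set (SD3Sentence U G M) :=
  if SD3Eval P .admin [.user a, .group g] then P ∪ {memberS v g 0 ⊤} else P

def sRemoveMember (P : Set (SD3Sentence U G M)) (a v : U) (g : G) : Set (SD3Sentence U G M) :=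
  if SD3Eval P .admin [.user a, .group g] ∨ a = v then
    P \ {s | ∃ t₁ t₂ : ℕ∞, s = memberS v g t₁ t₂}
  else P

def lRemoveMember (P : Set (SD3Sentence U G M)) (a v : U) (g : G) : Set (SD3Sentence U G M) :=
  if SD3Eval P .admin [.user a, .group g] then
    (P ∪ {s | ∃ t c : ℕ∞, memberS v g t ⊤ ∈ P ∧ timeS c ∈ P ∧ s = memberS v g t c}) \
      {s | ∃ t : ℕ∞, s = memberS v g t ⊤ ∧ s ∈ P}
  else P

def post (P : Set (SD3Sentence U G M)) (v : U) (g : G) (m : M) : Set (SD3Sentence U G M) :=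
  if SD3Eval P .currMember [.user v, .group g] then
    tick (P ∪ {s | ∃ t : ℕ∞, timeS t ∈ P ∧ s = postS g m t})
  else P

end SD3

/-- The scheme SD3-GM. Commands and queries have the same names and parameters as in GMS. -/
def SD3GM (U G M : Type u) : Scheme.{u} where
  State := Set (SD3Sentence U G M)
  Cmd := GMCmd
  CmdParam := GMCmd.Param U G M
  exec := fun c => match c with
    | .createGroup => fun P (v, g) => SD3.createGroup P v g
    | .grantAdmin => fun P (o, v, g) => SD3.grantAdmin P o v g
    | .revokeAdmin => fun P (o, v, g) => SD3.revokeAdmin P o v g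
    | .sAddMember => fun P (a, v, g) => SD3.sAddMember P a v g
    | .lAddMember => fun P (a, v, g) => SD3.lAddMember P a v g
    | .sRemoveMember => fun P (a, v, g) => SD3.sRemoveMember P a v g
    | .lRemoveMember => fun P (a, v, g) => SD3.lRemoveMember P a v g
    | .post => fun P (v, g, m) => SD3.post P v g m
  Query := Unit
  QueryParam := fun _ => U × M
  entails := fun _ P (v, m) => SD3Eval P .access [.user v, .msg m]

/-- The policy of a GMS state: the two static rules and one fact for each tuple. -/
def sd3Policy {U G M : Type u} (γ : GMState U G M) : Set (SD3Sentence U G M) :=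
  {SD3.accessRule, SD3.currMemberRule} ∪ {SD3.timeS (γ.now : ℕ∞)} ∪
  {s | ∃ v g, (v, g) ∈ γ.owner ∧ s = SD3.ownS v g} ∪
  {s | ∃ v g, (v, g) ∈ γ.admin ∧ s = SD3.adminS v g} ∪
  {s | ∃ v g t₁ t₂, (v, g, t₁, t₂) ∈ γ.record ∧ s = SD3.memberS v g t₁ t₂} ∪
  {s | ∃ g m t, (g, m, t) ∈ γ.transcript ∧ s = SD3.postS g m t}

/-- The implementation of GMS in SD3-GM; commands and queries are mapped identically. -/
def sd3Impl (U G M : Type u) : Implementation (GMS U G M) (SD3GM U G M) where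
  stateMap := fun γ => sd3Policy (γ : GMState U G M)
  cmdMap := fun c p _ => [⟨c, p⟩]
  queryMap := fun q => q
  queryArg := fun _ p => p

/-! ## RBAC, extended with groups and a group-message relation -/

/-- A state of RBAC over users `U`, permissions `P` and role names `Ro`. Commands may leave
assignments to names that are not (or no longer) roles, so `ua` and `pa` are relations to role
names. -/
structure RBACState (U P Ro : Type u) where
  roles : Finset Ro
  ua : Finset (U × Ro)
  pa : Finset (P × Ro)

inductive RBACCmd
  | addRole | deleteRole | assignUser | deassignUser | grantPermission | revokePermission

def RBACCmd.Param (U P Ro : Type u) : RBACCmd → Type u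
  | .addRole => U × Ro
  | .deleteRole => U × Ro
  | .assignUser => U × U × Ro
  | .deassignUser => U × U × Ro
  | .grantPermission => U × P × Ro
  | .revokePermission => U × P × Ro

inductive RBACQuery
  | access | assigned

def RBACQuery.Param (U P Ro : Type u) : RBACQuery → Type u
  | .access => U × P
  | .assigned => U × Ro

/-- RBAC with the distinguished role name `adm`. -/
def RBAC (U P : Type u) {Ro : Type u} (adm : Ro) : Scheme.{u} where
  State := RBACState U P Ro
  Cmd := RBACCmd
  CmdParam := RBACCmd.Param U P Ro
  exec := fun c => match c with
    | .addRole => fun γ (a, r) =>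
        if (a, adm) ∈ γ.ua then { γ with roles := γ.roles ∪ {r} } else γ
    | .deleteRole => fun γ (a, r) =>
        if (a, adm) ∈ γ.ua then { γ with roles := γ.roles \ {r} } else γ
    | .assignUser => fun γ (a, v, r) =>
        if (a, adm) ∈ γ.ua then { γ with ua := γ.ua ∪ {(v, r)} } else γ
    | .deassignUser => fun γ (a, v, r) =>
        if (a, adm) ∈ γ.ua then { γ with ua := γ.ua \ {(v, r)} } else γ
    | .grantPermission => fun γ (a, p, r) =>
        if (a, adm) ∈ γ.ua then { γ with pa := γ.pa ∪ {(p, r)} } else γ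
    | .revokePermission => fun γ (a, p, r) =>
        if (a, adm) ∈ γ.ua then { γ with pa := γ.pa \ {(p, r)} } else γ
  Query := RBACQuery
  QueryParam := RBACQuery.Param U P Ro
  entails := fun q => match q with
    | .access => fun γ (v, p) => ∃ r ∈ γ.roles, (v, r) ∈ γ.ua ∧ (p, r) ∈ γ.pa
    | .assigned => fun γ (v, r) => (v, r) ∈ γ.ua

structure AuxUState (G P : Type u) where
  groups : Finset G
  gm : Finset (G × P)

inductive AuxUCmd
  | createGroup | associateWithGroup

def AuxUCmd.Param (U G P : Type u) : AuxUCmd → Type u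
  | .createGroup => U × G
  | .associateWithGroup => U × G × P

/-- The auxiliary machine for RBAC. It adds no queries. -/
def AuxU (U G P : Type u) {Ro : Type u} (adm : Ro) : AuxMachine (RBAC U P adm) where
  State := AuxUState G P
  Cmd := AuxUCmd
  CmdParam := AuxUCmd.Param U G P
  exec := fun c => match c with
    | .createGroup => fun (ρ : RBACState U P Ro) γ (v, g) =>
        if (v, adm) ∈ ρ.ua then { γ with groups := γ.groups ∪ {g} } else γ
    | .associateWithGroup => fun (ρ : RBACState U P Ro) γ (v, g, p) =>
        if (v, adm) ∈ ρ.ua then { γ with gm := γ.gm ∪ {(g, p)} } else γ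
  Query := Empty
  QueryParam := fun _ => PEmpty
  entails := fun q => q.elim

/-- The role names used by the implementation: `admin`, a role `r^m` for each message, and roles
`m^g`, `o^g`, `a^g` for membership, ownership and administration of each group. -/
inductive RoleName (G M : Type u)
  | admin | msg (m : M) | member (g : G) | owner (g : G) | groupAdmin (g : G)

namespace GMState

variable {U G M : Type u}

/-- The messages posted to any group. -/
def posted (γ : GMState U G M) : Finset M := γ.transcript.image fun x => x.2.1

/-- The pairs `(v, g)` such that `v` is currently a member of `g`. -/
def current (γ : GMState U G M) : Finset (U × G) :=
  (γ.record.filter fun x => x.2.2.2 = ⊤).image fun x => (x.1, x.2.1)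

/-- The pairs `(g, m)` such that `m` was posted to `g`. -/
def groupMessage (γ : GMState U G M) : Finset (G × M) :=
  γ.transcript.image fun x => (x.1, x.2.1)

end GMState

section RBACImpl

variable {U G M P Ro : Type u} [Fintype U]

/-- The RBAC part of the image of a GMS state. All users are assigned to the role `admin`. -/
def rbacState (perm : M ↪ P) (role : RoleName G M ↪ Ro) (γ : GMState U G M) :
    RBACState U P Ro where
  roles := {role .admin} ∪ (γ.posted.image fun m => role (.msg m)) ∪
    (γ.groups.image fun g => role (.member g)) ∪
    (γ.groups.image fun g => role (.owner g)) ∪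
    (γ.groups.image fun g => role (.groupAdmin g))
  ua := (Finset.univ.image fun v => (v, role .admin)) ∪
    (((Finset.univ ×ˢ γ.posted).filter fun x => γ.Access x.1 x.2).image
      fun x => (x.1, role (.msg x.2))) ∪
    (γ.current.image fun x => (x.1, role (.member x.2))) ∪
    (γ.owner.image fun x => (x.1, role (.owner x.2))) ∪
    (γ.admin.image fun x => (x.1, role (.groupAdmin x.2)))
  pa := γ.posted.image fun m => (perm m, role (.msg m))

def auxUState (perm : M ↪ P) (γ : GMState U G M) : AuxUState G P where
  groups := γ.groups
  gm := γ.groupMessage.image fun x => (x.1, perm x.2)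

/-- The extended scheme `RBAC ∘ U`. -/
abbrev RBACU (U G P : Type u) {Ro : Type u} (adm : Ro) : Scheme.{u} :=
  (RBAC U P adm).augment (AuxU U G P adm)

/-- A parameterized command of RBAC, as a command of the extended scheme. -/
def rb {U G P Ro : Type u} {adm : Ro} (c : RBACCmd) (p : c.Param U P Ro) :
    (d : (RBACU U G P adm).Cmd) × (RBACU U G P adm).CmdParam d :=
  ⟨Sum.inl c, p⟩

/-- A parameterized command of the auxiliary machine, as a command of the extended scheme. -/
def rx {U G P Ro : Type u} {adm : Ro} (c : AuxUCmd) (p : c.Param U G P) :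
    (d : (RBACU U G P adm).Cmd) × (RBACU U G P adm).CmdParam d :=
  ⟨Sum.inr c, p⟩

/-- A list of the messages `m` with `(g, m) ∈ GM`. -/
def groupMsgs {O : Type u} (obj : M ↪ O) (gm : Finset (G × O)) (g : G) : List M :=
  (((gm.filter fun x => x.1 = g).image Prod.snd).preimage obj obj.injective.injOn).toList

/-- The implementation of GMS in `RBAC ∘ U`. -/
def rbacImpl (perm : M ↪ P) (role : RoleName G M ↪ Ro) :
    Implementation (GMS U G M) (RBACU U G P (role .admin)) where
  stateMap := fun γ => (rbacState perm role (γ : GMState U G M), auxUState perm γ)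
  cmdMap := fun c => match c with
    | .createGroup => fun (v, g) _ =>
        [rx .createGroup (v, g),
         rb .addRole (v, role (.member g)), rb .assignUser (v, v, role (.member g)),
         rb .addRole (v, role (.owner g)), rb .assignUser (v, v, role (.owner g)),
         rb .addRole (v, role (.groupAdmin g)), rb .assignUser (v, v, role (.groupAdmin g))]
    | .grantAdmin => fun (v, w, g) _ => [rb .assignUser (v, w, role (.groupAdmin g))]
    | .revokeAdmin => fun (v, w, g) _ => [rb .deassignUser (v, w, role (.groupAdmin g))]
    | .sAddMember => fun (v, w, g) _ => [rb .assignUser (v, w, role (.member g))]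
    | .lAddMember => fun (v, w, g) (δ : RBACState U P Ro × AuxUState G P) =>
        rb .assignUser (v, w, role (.member g)) ::
          (groupMsgs perm δ.2.gm g).map fun m => rb .assignUser (v, w, role (.msg m))
    | .sRemoveMember => fun (v, w, g) (δ : RBACState U P Ro × AuxUState G P) =>
        rb .deassignUser (v, w, role (.member g)) ::
          (groupMsgs perm δ.2.gm g).map fun m => rb .deassignUser (v, w, role (.msg m))
    | .lRemoveMember => fun (v, w, g) _ => [rb .deassignUser (v, w, role (.member g))]
    | .post => fun (v, g, m) (δ : RBACState U P Ro × AuxUState G P) =>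
        rx .associateWithGroup (v, g, perm m) ::
          ((Finset.univ.filter fun w => (w, role (.member g)) ∈ δ.1.ua).toList.map
            fun w => rb .assignUser (v, w, role (.msg m)))
  queryMap := fun _ => Sum.inl .access
  queryArg := fun _ (v, m) => (v, perm m)

end RBACImpl

/-! ## DAC, extended with groups, ownership, administration and membership -/

inductive DACCmd
  | grant | revoke

/-- DAC over subjects `S`, objects `O` and rights `I`, with the distinguished right `own`. A state
is the access matrix; subjects, objects and rights are changed by no command. -/
def DAC (S O : Type u) {I : Type u} (own : I) : Scheme.{u} where
  State := S → O → Set I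
  Cmd := DACCmd
  CmdParam := fun _ => S × S × O × I
  exec := fun c => match c with
    | .grant => fun A (s, t, o, i) =>
        if own ∈ A s o ∧ i ≠ own then
          fun s' o' => if s' = t ∧ o' = o then A s' o' ∪ {i} else A s' o'
        else A
    | .revoke => fun A (s, t, o, i) =>
        if own ∈ A s o ∧ i ≠ own then
          fun s' o' => if s' = t ∧ o' = o then A s' o' \ {i} else A s' o'
        else A
  Query := Unit
  QueryParam := fun _ => S × O × I
  entails := fun _ A (s, o, i) => i ∈ A s o

structure AuxVState (S G O : Type u) where
  groups : Finset G
  gm : Finset (G × O)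
  owner : Finset (S × G)
  admin : Finset (S × G)
  member : Finset (S × G)

inductive AuxVCmd
  | createGroup | associateWithGroup | grantAdmin | revokeAdmin | grantMember | revokeMember

def AuxVCmd.Param (S G O : Type u) : AuxVCmd → Type u
  | .createGroup => S × G
  | .associateWithGroup => S × G × O
  | _ => S × S × G

/-- The auxiliary machine for DAC. It adds no queries. -/
def AuxV (S G O : Type u) {I : Type u} (own : I) : AuxMachine (DAC S O own) where
  State := AuxVState S G O
  Cmd := AuxVCmd
  CmdParam := AuxVCmd.Param S G O
  exec := fun c => match c with
    | .createGroup => fun _ γ (s, g) =>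
        { γ with
          groups := γ.groups ∪ {g}
          owner := γ.owner ∪ {(s, g)}
          admin := γ.admin ∪ {(s, g)}
          member := γ.member ∪ {(s, g)} }
    | .associateWithGroup => fun _ γ (s, g, o) =>
        if (s, g) ∈ γ.member then { γ with gm := γ.gm ∪ {(g, o)} } else γ
    | .grantAdmin => fun _ γ (s, t, g) =>
        if (s, g) ∈ γ.owner then { γ with admin := γ.admin ∪ {(t, g)} } else γ
    | .revokeAdmin => fun _ γ (s, t, g) =>
        if (s, g) ∈ γ.owner ∨ s = t then { γ with admin := γ.admin \ {(t, g)} } else γ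
    | .grantMember => fun _ γ (s, t, g) =>
        if (s, g) ∈ γ.admin then { γ with member := γ.member ∪ {(t, g)} } else γ
    | .revokeMember => fun _ γ (s, t, g) =>
        if (s, g) ∈ γ.admin then { γ with member := γ.member \ {(t, g)} } else γ
  Query := Empty
  QueryParam := fun _ => PEmpty
  entails := fun q => q.elim

/-- The access rights used by the implementation: reading, and ownership. -/
inductive Right : Type u
  | read | own

section DACImpl

variable {U G M O : Type u} [Fintype U]

/-- The access matrix of a GMS state: every subject owns every object, and `v` may read the object
of `m` if and only if `v` has access to `m`. -/
def dacMatrix (obj : M ↪ O) (γ : GMState U G M) : U → O → Set Right.{u} :=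
  fun v o => {i | i = .own ∨ (i = .read ∧ ∃ m, obj m = o ∧ γ.Access v m)}

def auxVState (obj : M ↪ O) (γ : GMState U G M) : AuxVState U G O where
  groups := γ.groups
  gm := γ.groupMessage.image fun x => (x.1, obj x.2)
  owner := γ.owner
  admin := γ.admin
  member := γ.current

/-- The extended scheme `DAC ∘ V`, with rights `{read, own}`. -/
abbrev DACV (S G O : Type u) : Scheme.{u} :=
  (DAC S O Right.own.{u}).augment (AuxV S G O Right.own.{u})

/-- A parameterized command of DAC, as a command of the extended scheme. -/
def db {S G O : Type u} (c : DACCmd) (p : S × S × O × Right.{u}) :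
    (d : (DACV S G O).Cmd) × (DACV S G O).CmdParam d :=
  ⟨Sum.inl c, p⟩

/-- A parameterized command of the auxiliary machine, as a command of the extended scheme. -/
def dx {S G O : Type u} (c : AuxVCmd) (p : c.Param S G O) :
    (d : (DACV S G O).Cmd) × (DACV S G O).CmdParam d :=
  ⟨Sum.inr c, p⟩

/-- The implementation of GMS in `DAC ∘ V`. -/
def dacImpl (obj : M ↪ O) : Implementation (GMS U G M) (DACV U G O) where
  stateMap := fun γ => (dacMatrix obj (γ : GMState U G M), auxVState obj γ)
  cmdMap := fun c => match c with
    | .createGroup => fun (v, g) _ => [dx .createGroup (v, g)]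
    | .grantAdmin => fun (v, w, g) _ => [dx .grantAdmin (v, w, g)]
    | .revokeAdmin => fun (v, w, g) _ => [dx .revokeAdmin (v, w, g)]
    | .sAddMember => fun (v, w, g) _ => [dx .grantMember (v, w, g)]
    | .lAddMember => fun (v, w, g) (δ : (U → O → Set Right.{u}) × AuxVState U G O) =>
        dx .grantMember (v, w, g) ::
          (groupMsgs obj δ.2.gm g).map fun m => db .grant (v, w, obj m, .read)
    | .sRemoveMember => fun (v, w, g) (δ : (U → O → Set Right.{u}) × AuxVState U G O) =>
        dx .revokeMember (v, w, g) ::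
          (groupMsgs obj δ.2.gm g).map fun m => db .revoke (v, w, obj m, .read)
    | .lRemoveMember => fun (v, w, g) _ => [dx .revokeMember (v, w, g)]
    | .post => fun (v, g, m) (δ : (U → O → Set Right.{u}) × AuxVState U G O) =>
        dx .associateWithGroup (v, g, obj m) ::
          ((Finset.univ.filter fun w => (w, g) ∈ δ.2.member).toList.map
            fun w => db .grant (v, w, obj m, .read))
  queryMap := fun _ => Sum.inl ()
  queryArg := fun _ (v, m) => (v, obj m, .read)

end DACImpl

end

end ACS

/-! The three implementations fall to two different arguments.

For SD3-GM the state map is a faithful encoding: `sd3Policy γ` consists of two fixed rules and one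
ground fact per tuple of `γ`. OWN, ADMIN, MEMBER and POST head no rule, so atoms over them hold
exactly when they are facts of the policy. CURRMEMBER and ACCESS head one rule each, and inverting
that rule gives the GMS condition. Hence the conditions of the commands agree on both sides, and the
updates agree fact by fact (`sd3Impl_exec`). With `sd3Impl_equiv` this carries paths in either
direction.

For RBAC∘U and DAC∘V no command has to be simulated. State-matching compares only answers to queries
at reachable states, and these answers are determined by the access relation, a set of pairs of a
user and a message. It suffices that this set is always finite and that every finite set is attained
from every GMS state and from every image of one (`Implementation.isStateMatching_of_finite`). To
attain a finite set, clear the relation and then insert pairs one at a time.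

In GMS, users may remove themselves from any group, which empties the records. A fresh group,
available since `G` is infinite, then gives its creator access to one message without affecting
other pairs. In DAC every subject owns every object, so entries for `read` can be set freely. In
RBAC every user is an administrator, and accesses are exactly the assignments to the message roles.
The auxiliary machines can stay idle on the paths constructed. -/

namespace ACS

open scoped Classical

/-! ### Sentences and equality of policies -/

namespace SD3

variable {U G M : Type u}

theorem fact_inj {p q : SD3Pred} {l k : List (SD3Const U G M)} :
    fact p l = fact q k ↔ p = q ∧ l = k := by
  have hc : Function.Injective (SD3Term.const : SD3Const U G M → SD3Term U G M) :=
    fun a b h => by injection h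
  simp [fact, (List.map_injective_iff.2 hc).eq_iff]

theorem fact_ne_accessRule (p : SD3Pred) (l : List (SD3Const U G M)) :
    fact p l ≠ accessRule := by
  simp [fact, accessRule]

theorem fact_ne_currMemberRule (p : SD3Pred) (l : List (SD3Const U G M)) :
    fact p l ≠ currMemberRule := by
  simp [fact, currMemberRule]

/-- The sentences that occur in the image of a GMS state. -/
inductive Shaped : SD3Sentence U G M → Prop
  | access : Shaped accessRule
  | currMember : Shaped currMemberRule
  | time (t : ℕ∞) : Shaped (timeS t)
  | own (v : U) (g : G) : Shaped (ownS v g)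
  | admin (v : U) (g : G) : Shaped (adminS v g)
  | member (v : U) (g : G) (t₁ t₂ : ℕ∞) : Shaped (memberS v g t₁ t₂)
  | post (g : G) (m : M) (t : ℕ∞) : Shaped (postS g m t)

/-- Policies could contain arbitrary Datalog sentences. Restricting the comparison to the shapes
that actually occur turns equality into seven cases, each decided by looking up a rule or a fact. -/
theorem policy_ext {P Q : Set (SD3Sentence U G M)}
    (hP : ∀ s ∈ P, Shaped s) (hQ : ∀ s ∈ Q, Shaped s)
    (h : ∀ s, Shaped s → (s ∈ P ↔ s ∈ Q)) : P = Q :=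
  Set.ext fun s => ⟨fun hs => (h s (hP s hs)).1 hs, fun hs => (h s (hQ s hs)).2 hs⟩

end SD3

/-! ### The policy of a GMS state: its facts and the atoms derivable from it -/

section Policy

variable {U G M : Type u} (γ : GMState U G M)

open SD3

theorem shaped_of_mem_sd3Policy : ∀ s ∈ sd3Policy γ, Shaped s := by
  rintro s (((((h | h) | h) | h) | h) | h)
  · rcases h with rfl | rfl <;> constructor
  · rw [Set.mem_singleton_iff.1 h]; constructor
  · obtain ⟨v, g, -, rfl⟩ := h; constructor
  · obtain ⟨v, g, -, rfl⟩ := h; constructor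
  · obtain ⟨v, g, t₁, t₂, -, rfl⟩ := h; constructor
  · obtain ⟨g, m, t, -, rfl⟩ := h; constructor

theorem accessRule_mem_sd3Policy : accessRule ∈ sd3Policy γ := by simp [sd3Policy]

theorem currMemberRule_mem_sd3Policy : currMemberRule ∈ sd3Policy γ := by simp [sd3Policy]

theorem fact_time_mem_sd3Policy (t : ℕ∞) : fact .time [.time t] ∈ sd3Policy γ ↔ t = γ.now := by
  simp [sd3Policy, timeS, ownS, adminS, memberS, postS, fact_inj, fact_ne_accessRule,
    fact_ne_currMemberRule]

theorem fact_own_mem_sd3Policy (v : U) (g : G) : fact .own [.user v, .group g] ∈ sd3Policy γ ↔ (v, g) ∈ γ.owner := by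
  simp [sd3Policy, timeS, ownS, adminS, memberS, postS, fact_inj, fact_ne_accessRule,
    fact_ne_currMemberRule]

theorem fact_admin_mem_sd3Policy (v : U) (g : G) : fact .admin [.user v, .group g] ∈ sd3Policy γ ↔ (v, g) ∈ γ.admin := by
  simp [sd3Policy, timeS, ownS, adminS, memberS, postS, fact_inj, fact_ne_accessRule,
    fact_ne_currMemberRule]

theorem fact_member_mem_sd3Policy (v : U) (g : G) (t₁ t₂ : ℕ∞) :
    fact .member [.user v, .group g, .time t₁, .time t₂] ∈ sd3Policy γ ↔ (v, g, t₁, t₂) ∈ γ.record := by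
  simp [sd3Policy, timeS, ownS, adminS, memberS, postS, fact_inj, fact_ne_accessRule,
    fact_ne_currMemberRule]

theorem fact_post_mem_sd3Policy (g : G) (m : M) (t : ℕ∞) :
    fact .post [.group g, .msg m, .time t] ∈ sd3Policy γ ↔ (g, m, t) ∈ γ.transcript := by
  simp [sd3Policy, timeS, ownS, adminS, memberS, postS, fact_inj, fact_ne_accessRule,
    fact_ne_currMemberRule]

/-! ### Evaluation of ground atoms -/

/-- Inversion with the predicate and the arguments as equations: the indices `s.head.pred` and
`s.head.args.map _` of the rule constructor are not patterns that case analysis on a concrete atom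
could unify. -/
theorem SD3Eval_iff {P : Set (SD3Sentence U G M)} {p : SD3Pred} {l : List (SD3Const U G M)} :
    SD3Eval P p l ↔
      (∃ t₁ t₂ : ℕ∞, t₁ ≤ t₂ ∧ p = .lesseq ∧ l = [.time t₁, .time t₂]) ∨
      ∃ s ∈ P, ∃ v : ℕ → SD3Const U G M,
        (∀ a ∈ s.body, SD3Eval P a.pred (a.args.map (SD3Term.inst v))) ∧
        p = s.head.pred ∧ l = s.head.args.map (SD3Term.inst v) := by
  constructor
  · rintro (⟨t₁, t₂, h⟩ | ⟨s, hs, v, h⟩)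
    · exact .inl ⟨t₁, t₂, h, rfl, rfl⟩
    · exact .inr ⟨s, hs, v, h, rfl, rfl⟩
  · rintro (⟨t₁, t₂, h, rfl, rfl⟩ | ⟨s, hs, v, h, rfl, rfl⟩)
    · exact .lesseq t₁ t₂ h
    · exact .rule s hs v h

theorem map_inst_map_const (v : ℕ → SD3Const U G M) (l : List (SD3Const U G M)) :
    (l.map SD3Term.const).map (SD3Term.inst v) = l := by
  simp [Function.comp_def, SD3Term.inst]

theorem SD3Eval_of_fact_mem {P : Set (SD3Sentence U G M)} {p : SD3Pred}
    {l : List (SD3Const U G M)} (h : fact p l ∈ P) : SD3Eval P p l := by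
  -- A fact contains no variables, so any assignment serves. A timestamp is a constant that exists
  -- even if `U`, `G` and `M` are empty.
  have v : ℕ → SD3Const U G M := fun _ => .time 0
  have := SD3Eval.rule (fact p l) h v (by simp [fact])
  rwa [show (fact p l).head.args = l.map .const from rfl, map_inst_map_const] at this

/-- A predicate that is not the head of a rule is evaluated by looking up facts. -/
theorem SD3Eval_sd3Policy_iff_fact_mem {p : SD3Pred} {l : List (SD3Const U G M)}
    (h₁ : p ≠ .access) (h₂ : p ≠ .currMember) (h₃ : p ≠ .lesseq) :
    SD3Eval (sd3Policy γ) p l ↔ fact p l ∈ sd3Policy γ := by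
  refine ⟨fun h => ?_, SD3Eval_of_fact_mem⟩
  rcases SD3Eval_iff.1 h with ⟨-, -, -, h, -⟩ | ⟨s, hs, v, -, rfl, rfl⟩
  · exact absurd h h₃
  · cases shaped_of_mem_sd3Policy γ s hs with
    | access => exact absurd rfl h₁
    | currMember => exact absurd rfl h₂
    | _ => exact hs

theorem SD3Eval_own (v : U) (g : G) :
    SD3Eval (sd3Policy γ) .own [.user v, .group g] ↔ (v, g) ∈ γ.owner :=
  (SD3Eval_sd3Policy_iff_fact_mem γ (by simp) (by simp) (by simp)).trans
    (fact_own_mem_sd3Policy γ v g)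

theorem SD3Eval_admin (v : U) (g : G) :
    SD3Eval (sd3Policy γ) .admin [.user v, .group g] ↔ (v, g) ∈ γ.admin :=
  (SD3Eval_sd3Policy_iff_fact_mem γ (by simp) (by simp) (by simp)).trans
    (fact_admin_mem_sd3Policy γ v g)

theorem SD3Eval_member (l : List (SD3Const U G M)) :
    SD3Eval (sd3Policy γ) .member l ↔
      ∃ v g t₁ t₂, (v, g, t₁, t₂) ∈ γ.record ∧
        l = [.user v, .group g, .time t₁, .time t₂] := by
  rw [SD3Eval_sd3Policy_iff_fact_mem γ (by simp) (by simp) (by simp)]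
  simp [sd3Policy, timeS, ownS, adminS, memberS, postS, fact_inj, fact_ne_accessRule,
    fact_ne_currMemberRule]

theorem SD3Eval_post (l : List (SD3Const U G M)) :
    SD3Eval (sd3Policy γ) .post l ↔
      ∃ g m t, (g, m, t) ∈ γ.transcript ∧ l = [.group g, .msg m, .time t] := by
  rw [SD3Eval_sd3Policy_iff_fact_mem γ (by simp) (by simp) (by simp)]
  simp [sd3Policy, timeS, ownS, adminS, memberS, postS, fact_inj, fact_ne_accessRule,
    fact_ne_currMemberRule]

theorem SD3Eval_lesseq (l : List (SD3Const U G M)) :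
    SD3Eval (sd3Policy γ) .lesseq l ↔ ∃ t₁ t₂ : ℕ∞, t₁ ≤ t₂ ∧ l = [.time t₁, .time t₂] := by
  constructor
  · intro h
    rcases SD3Eval_iff.1 h with ⟨t₁, t₂, h, -, h'⟩ | ⟨s, hs, v, -, h, -⟩
    · exact ⟨t₁, t₂, h, h'⟩
    · cases shaped_of_mem_sd3Policy γ s hs <;> exact absurd h (by
        simp [accessRule, currMemberRule, timeS, ownS, adminS, memberS, postS, fact])
  · rintro ⟨t₁, t₂, h, rfl⟩
    exact .lesseq t₁ t₂ h

theorem SD3Eval_currMember (v : U) (g : G) :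
    SD3Eval (sd3Policy γ) .currMember [.user v, .group g] ↔
      ∃ t : ℕ∞, (v, g, t, ⊤) ∈ γ.record := by
  constructor
  · intro h
    rcases SD3Eval_iff.1 h with ⟨-, -, -, h, -⟩ | ⟨s, hs, a, hb, hp, hl⟩
    · simp at h
    · cases shaped_of_mem_sd3Policy γ s hs with
      | currMember =>
        simp only [currMemberRule, List.map_cons, List.map_nil, SD3Term.inst, List.mem_singleton,
          forall_eq, SD3Eval_member, List.cons.injEq] at hb hl
        obtain ⟨v', g', t₁, t₂, hr, h0, h1, -, h3, -⟩ := hb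
        -- The head fixes the values of variables 0 and 1, and the constant in the body forces the
        -- second timestamp to be `⊤`.
        rw [← hl.1] at h0
        rw [← hl.2.1] at h1
        cases h0; cases h1; cases h3
        exact ⟨t₁, hr⟩
      | _ => simp [accessRule, timeS, ownS, adminS, memberS, postS, fact] at hp
  · rintro ⟨t, ht⟩
    refine SD3Eval.rule currMemberRule (currMemberRule_mem_sd3Policy γ)
      (fun n => match n with | 0 => .user v | 1 => .group g | _ => .time t) ?_
    simp only [currMemberRule, List.map_cons, List.map_nil, SD3Term.inst, List.mem_singleton,
      forall_eq, SD3Eval_member]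
    exact ⟨v, g, t, ⊤, ht, rfl⟩

theorem SD3Eval_access (v : U) (m : M) :
    SD3Eval (sd3Policy γ) .access [.user v, .msg m] ↔ γ.Access v m := by
  constructor
  · intro h
    rcases SD3Eval_iff.1 h with ⟨-, -, -, h, -⟩ | ⟨s, hs, a, hb, hp, hl⟩
    · simp at h
    · cases shaped_of_mem_sd3Policy γ s hs with
      | access =>
        simp only [accessRule, List.map_cons, List.map_nil, SD3Term.inst, List.mem_cons,
          List.not_mem_nil, or_false, forall_eq_or_imp, forall_eq, SD3Eval_member, SD3Eval_post,
          SD3Eval_lesseq, List.cons.injEq] at hb hl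
        obtain ⟨⟨v', g, t₁, t₂, hr, h0, h2, h3, h4, -⟩, ⟨g', m', t, ht, h2', h1, h5, -⟩,
          ⟨s₁, s, hs, h3', h5', -⟩, ⟨s', s₂, hs', h5'', h4', -⟩⟩ := hb
        rw [← hl.1] at h0
        -- Each body atom was inverted separately with its own witnesses; the shared variables of
        -- the rule identify them with one another.
        rw [← hl.2.1] at h1
        rw [h2] at h2'
        rw [h3] at h3'
        rw [h4] at h4'
        rw [h5] at h5' h5''
        cases h0; cases h1; cases h2'; cases h3'; cases h4'; cases h5'; cases h5''
        -- The rule does not ask that `g` be an existing group; the well-formedness of GMS states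
        -- supplies this.
        exact ⟨g, γ.record_sub _ hr, t₁, t, t₂, hr, ht, hs, hs'⟩
      | _ => simp [currMemberRule, timeS, ownS, adminS, memberS, postS, fact] at hp
  · rintro ⟨g, -, tl, t, tu, hr, ht, h, h'⟩
    refine SD3Eval.rule accessRule (accessRule_mem_sd3Policy γ)
      (fun n => match n with
        | 0 => .user v | 1 => .msg m | 2 => .group g | 3 => .time tl | 4 => .time tu
        | _ => .time t) ?_
    simp only [accessRule, List.map_cons, List.map_nil, SD3Term.inst, List.mem_cons,
      List.not_mem_nil, or_false, forall_eq_or_imp, forall_eq, SD3Eval_member, SD3Eval_post,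
      SD3Eval_lesseq]
    exact ⟨⟨v, g, tl, tu, hr, rfl⟩, ⟨g, m, t, ht, rfl⟩, ⟨tl, t, h, rfl⟩, ⟨t, tu, h', rfl⟩⟩

end Policy

/-! ### SD3-GM follows GMS in lock-step -/

section LockStep

variable {U G M : Type u} (γ : GMState U G M)

open SD3

theorem SD3.shaped_tick {P : Set (SD3Sentence U G M)} (h : ∀ s ∈ P, Shaped s) :
    ∀ s ∈ tick P, Shaped s := by
  rintro s ⟨hs | ⟨t, -, rfl⟩, -⟩
  · exact h s hs
  · constructor

/-- Used for `tick`, which deletes the old TIME fact after adding the new one: the two must differ.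
This would fail for the timestamp `⊤`, but the current time is a natural number. -/
theorem natCast_add_one_ne_self (n : ℕ) : (n : ℕ∞) + 1 ≠ n := by
  exact_mod_cast n.succ_ne_self

theorem sd3Policy_createGroup (v : U) (g : G) :
    SD3.createGroup (sd3Policy γ) v g = sd3Policy (γ.createGroup v g) := by
  refine policy_ext ?_ (shaped_of_mem_sd3Policy _) fun s hs => ?_
  · rintro s (h | rfl | rfl | rfl)
    · exact shaped_of_mem_sd3Policy γ s h
    all_goals constructor
  · cases hs <;>
      simp [SD3.createGroup, GMState.createGroup, timeS, ownS, adminS, memberS, postS, fact_inj,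
        accessRule_mem_sd3Policy, currMemberRule_mem_sd3Policy, fact_time_mem_sd3Policy,
        fact_own_mem_sd3Policy, fact_admin_mem_sd3Policy, fact_member_mem_sd3Policy,
        fact_post_mem_sd3Policy]

theorem sd3Policy_grantAdmin (o v : U) (g : G) :
    SD3.grantAdmin (sd3Policy γ) o v g = sd3Policy (γ.grantAdmin o v g) := by
  rw [SD3.grantAdmin, GMState.grantAdmin]
  simp only [SD3Eval_own]
  split_ifs with h
  swap
  · rfl
  refine policy_ext ?_ (shaped_of_mem_sd3Policy _) fun s hs => ?_
  · rintro s (h | rfl)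
    · exact shaped_of_mem_sd3Policy γ s h
    · constructor
  · cases hs <;>
      simp [timeS, ownS, adminS, memberS, postS, fact_inj,
        accessRule_mem_sd3Policy, currMemberRule_mem_sd3Policy, fact_time_mem_sd3Policy,
        fact_own_mem_sd3Policy, fact_admin_mem_sd3Policy, fact_member_mem_sd3Policy,
        fact_post_mem_sd3Policy]

theorem sd3Policy_revokeAdmin (o v : U) (g : G) :
    SD3.revokeAdmin (sd3Policy γ) o v g = sd3Policy (γ.revokeAdmin o v g) := by
  rw [SD3.revokeAdmin, GMState.revokeAdmin]
  simp only [SD3Eval_own]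
  split_ifs with h
  swap
  · rfl
  refine policy_ext ?_ (shaped_of_mem_sd3Policy _) fun s hs => ?_
  · exact fun s h => shaped_of_mem_sd3Policy γ s h.1
  · cases hs <;>
      simp [timeS, ownS, adminS, memberS, postS, fact_inj, (fact_ne_accessRule _ _).symm,
        (fact_ne_currMemberRule _ _).symm,
        accessRule_mem_sd3Policy, currMemberRule_mem_sd3Policy, fact_time_mem_sd3Policy,
        fact_own_mem_sd3Policy, fact_admin_mem_sd3Policy, fact_member_mem_sd3Policy,
        fact_post_mem_sd3Policy]

theorem sd3Policy_sAddMember (a v : U) (g : G) :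
    SD3.sAddMember (sd3Policy γ) a v g = sd3Policy (γ.sAddMember a v g) := by
  rw [SD3.sAddMember, GMState.sAddMember]
  simp only [SD3Eval_admin]
  split_ifs with h
  swap
  · rfl
  refine policy_ext (shaped_tick ?_) (shaped_of_mem_sd3Policy _) fun s hs => ?_
  · rintro s (h | ⟨t, -, rfl⟩)
    · exact shaped_of_mem_sd3Policy γ s h
    · constructor
  · have := natCast_add_one_ne_self γ.now
    cases hs <;>
      simp [tick, timeS, ownS, adminS, memberS, postS, fact_inj, (fact_ne_accessRule _ _).symm,
        (fact_ne_currMemberRule _ _).symm,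
        accessRule_mem_sd3Policy, currMemberRule_mem_sd3Policy, fact_time_mem_sd3Policy,
        fact_own_mem_sd3Policy, fact_admin_mem_sd3Policy, fact_member_mem_sd3Policy,
        fact_post_mem_sd3Policy]
    all_goals grind

theorem sd3Policy_lAddMember (a v : U) (g : G) :
    SD3.lAddMember (sd3Policy γ) a v g = sd3Policy (γ.lAddMember a v g) := by
  rw [SD3.lAddMember, GMState.lAddMember]
  simp only [SD3Eval_admin]
  split_ifs with h
  swap
  · rfl
  refine policy_ext ?_ (shaped_of_mem_sd3Policy _) fun s hs => ?_
  · rintro s (h | rfl)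
    · exact shaped_of_mem_sd3Policy γ s h
    · constructor
  · cases hs <;>
      simp [timeS, ownS, adminS, memberS, postS, fact_inj,
        accessRule_mem_sd3Policy, currMemberRule_mem_sd3Policy, fact_time_mem_sd3Policy,
        fact_own_mem_sd3Policy, fact_admin_mem_sd3Policy, fact_member_mem_sd3Policy,
        fact_post_mem_sd3Policy]

theorem sd3Policy_sRemoveMember (a v : U) (g : G) :
    SD3.sRemoveMember (sd3Policy γ) a v g = sd3Policy (γ.sRemoveMember a v g) := by
  rw [SD3.sRemoveMember, GMState.sRemoveMember]
  simp only [SD3Eval_admin]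
  split_ifs with h
  swap
  · rfl
  refine policy_ext ?_ (shaped_of_mem_sd3Policy _) fun s hs => ?_
  · exact fun s h => shaped_of_mem_sd3Policy γ s h.1
  · cases hs <;>
      simp [timeS, ownS, adminS, memberS, postS, fact_inj, (fact_ne_accessRule _ _).symm,
        (fact_ne_currMemberRule _ _).symm,
        accessRule_mem_sd3Policy, currMemberRule_mem_sd3Policy, fact_time_mem_sd3Policy,
        fact_own_mem_sd3Policy, fact_admin_mem_sd3Policy, fact_member_mem_sd3Policy,
        fact_post_mem_sd3Policy]

theorem sd3Policy_lRemoveMember (a v : U) (g : G) :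
    SD3.lRemoveMember (sd3Policy γ) a v g = sd3Policy (γ.lRemoveMember a v g) := by
  rw [SD3.lRemoveMember, GMState.lRemoveMember]
  simp only [SD3Eval_admin]
  split_ifs with h
  swap
  · rfl
  refine policy_ext ?_ (shaped_of_mem_sd3Policy _) fun s hs => ?_
  · rintro s ⟨h | ⟨t, c, -, -, rfl⟩, -⟩
    · exact shaped_of_mem_sd3Policy γ s h
    · constructor
  · cases hs <;>
      simp [timeS, ownS, adminS, memberS, postS, fact_inj, (fact_ne_accessRule _ _).symm,
        (fact_ne_currMemberRule _ _).symm,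
        accessRule_mem_sd3Policy, currMemberRule_mem_sd3Policy, fact_time_mem_sd3Policy,
        fact_own_mem_sd3Policy, fact_admin_mem_sd3Policy, fact_member_mem_sd3Policy,
        fact_post_mem_sd3Policy]
    all_goals grind

theorem sd3Policy_post (v : U) (g : G) (m : M) :
    SD3.post (sd3Policy γ) v g m = sd3Policy (γ.post v g m) := by
  rw [SD3.post, GMState.post]
  simp only [SD3Eval_currMember]
  split_ifs with h
  swap
  · rfl
  refine policy_ext (shaped_tick ?_) (shaped_of_mem_sd3Policy _) fun s hs => ?_
  · rintro s (h | ⟨t, -, rfl⟩)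
    · exact shaped_of_mem_sd3Policy γ s h
    · constructor
  · have := natCast_add_one_ne_self γ.now
    cases hs <;>
      simp [tick, timeS, ownS, adminS, memberS, postS, fact_inj, (fact_ne_accessRule _ _).symm,
        (fact_ne_currMemberRule _ _).symm,
        accessRule_mem_sd3Policy, currMemberRule_mem_sd3Policy, fact_time_mem_sd3Policy,
        fact_own_mem_sd3Policy, fact_admin_mem_sd3Policy, fact_member_mem_sd3Policy,
        fact_post_mem_sd3Policy]
    all_goals grind

/-- `sd3Impl` is a lock-step bisimulation: it commutes with every command. -/
theorem sd3Impl_exec (γ : (GMS U G M).State) (c : GMCmd) (p : c.Param U G M) :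
    (SD3GM U G M).exec c ((sd3Impl U G M).stateMap γ) p =
      (sd3Impl U G M).stateMap ((GMS U G M).exec c γ p) := by
  cases c with
  | createGroup => exact sd3Policy_createGroup γ _ _
  | grantAdmin => exact sd3Policy_grantAdmin γ _ _ _
  | revokeAdmin => exact sd3Policy_revokeAdmin γ _ _ _
  | sAddMember => exact sd3Policy_sAddMember γ _ _ _
  | lAddMember => exact sd3Policy_lAddMember γ _ _ _
  | sRemoveMember => exact sd3Policy_sRemoveMember γ _ _ _
  | lRemoveMember => exact sd3Policy_lRemoveMember γ _ _ _
  | post => exact sd3Policy_post γ _ _ _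

theorem sd3Impl_equiv (γ : (GMS U G M).State) :
    (sd3Impl U G M).Equiv γ ((sd3Impl U G M).stateMap γ) :=
  fun _ p => (SD3Eval_access γ p.1 p.2).symm

theorem sd3Impl_isStateMatching : (sd3Impl U G M).IsStateMatching := by
  intro γ
  constructor
  · intro γ₁ h
    refine ⟨(sd3Impl U G M).stateMap γ₁, ?_, sd3Impl_equiv γ₁⟩
    refine Relation.ReflTransGen.lift (sd3Impl U G M).stateMap ?_ _ _ h
    rintro γ γ' ⟨c, p, rfl⟩
    exact ⟨c, p, sd3Impl_exec γ c p⟩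
  · intro δ₁ h
    -- Agreement on queries alone would not survive another command. The induction needs the reached
    -- policy to be the image of a GMS state.
    suffices ∃ γ₁, (GMS U G M).Reach γ γ₁ ∧ (sd3Impl U G M).stateMap γ₁ = δ₁ by
      obtain ⟨γ₁, h₁, rfl⟩ := this
      exact ⟨γ₁, h₁, sd3Impl_equiv γ₁⟩
    induction h with
    | refl => exact ⟨γ, .refl, rfl⟩
    | tail _ hs ih =>
      obtain ⟨γ₁, h₁, rfl⟩ := ih
      obtain ⟨c, p, rfl⟩ := hs
      exact ⟨_, h₁.tail ⟨c, p, rfl⟩, (sd3Impl_exec γ₁ c p).symm⟩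

end LockStep

/-! ### Attaining every finite set of answers -/

section Reachability

variable {S W : Scheme.{u}} {X : Type*}

theorem Scheme.Reach.exec (S : Scheme.{u}) (δ : S.State) (c : S.Cmd) (p : S.CmdParam c) :
    S.Reach δ (S.exec c δ p) :=
  .single ⟨c, p, rfl⟩

/-- If the elements of the finite sets `f δ` can be deleted one at a time, `f` can be made empty. -/
theorem Scheme.exists_reach_eq_empty (f : S.State → Set X) (I : S.State → Prop)
    (erase : ∀ δ, I δ → ∀ x ∈ f δ, ∃ δ', S.Reach δ δ' ∧ I δ' ∧ f δ' ⊆ f δ \ {x})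
    (δ : S.State) (hI : I δ) (hf : (f δ).Finite) :
    ∃ δ', S.Reach δ δ' ∧ I δ' ∧ f δ' = ∅ := by
  obtain ⟨T, hT⟩ : ∃ T, f δ = T := ⟨_, rfl⟩
  rw [hT] at hf
  -- Only the inclusion is kept for the induction, since one deletion may remove more than the
  -- chosen element; removing a user from a group, for instance, deletes all records of that user
  -- there.
  replace hT := hT.subset
  induction T, hf using Set.Finite.induction_on generalizing δ with
  | empty => exact ⟨δ, .refl, hI, Set.subset_empty_iff.1 hT⟩
  | @insert x T hx _ ih =>
    by_cases h : x ∈ f δ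
    · obtain ⟨δ₁, h₁, hI₁, hf₁⟩ := erase δ hI x h
      obtain ⟨δ₂, h₂, hI₂, hf₂⟩ := ih δ₁ hI₁
        (hf₁.trans (by rw [Set.sdiff_singleton_subset_iff]; exact hT))
      exact ⟨δ₂, h₁.trans h₂, hI₂, hf₂⟩
    · exact ih δ hI ((Set.subset_insert_iff_of_notMem h).1 hT)

/-- Clear first, then insert the elements of `T` one by one. The invariant `I` records what keeps
the commands effective along the way. -/
theorem Scheme.exists_reach_eq_of_finite (f : S.State → Set X) (I : S.State → Prop)
    (clear : ∀ δ, I δ → ∃ δ', S.Reach δ δ' ∧ I δ' ∧ f δ' = ∅)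
    (add : ∀ δ, I δ → ∀ x, ∃ δ', S.Reach δ δ' ∧ I δ' ∧ f δ' = insert x (f δ))
    (δ : S.State) (hI : I δ) {T : Set X} (hT : T.Finite) :
    ∃ δ', S.Reach δ δ' ∧ f δ' = T := by
  suffices ∃ δ', S.Reach δ δ' ∧ I δ' ∧ f δ' = T by
    obtain ⟨δ', h, -, h'⟩ := this
    exact ⟨δ', h, h'⟩
  induction T, hT using Set.Finite.induction_on with
  | empty => exact clear δ hI
  | @insert x T _ _ ih =>
    obtain ⟨δ₁, h₁, hI₁, hf₁⟩ := ih
    obtain ⟨δ₂, h₂, hI₂, hf₂⟩ := add δ₁ hI₁ x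
    exact ⟨δ₂, h₁.trans h₂, hI₂, hf₂.trans (by rw [hf₁])⟩

/-- An implementation is state-matching if the answers to the queries are determined by finite
sets on both sides, and every finite set can be reached from every state. -/
theorem Implementation.isStateMatching_of_finite (σ : Implementation W S)
    (f : W.State → Set X) (k : S.State → Set X)
    (equiv : ∀ γ δ, f γ = k δ → σ.Equiv γ δ)
    (finite_left : ∀ γ, (f γ).Finite)
    (finite_right : ∀ γ δ, S.Reach (σ.stateMap γ) δ → (k δ).Finite)
    (reach_left : ∀ γ (T : Set X), T.Finite → ∃ γ', W.Reach γ γ' ∧ f γ' = T)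
    (reach_right : ∀ γ (T : Set X), T.Finite →
      ∃ δ, S.Reach (σ.stateMap γ) δ ∧ k δ = T) :
    σ.IsStateMatching := by
  refine fun γ => ⟨fun γ₁ _ => ?_, fun δ₁ h => ?_⟩
  -- The path to `γ₁` is not imitated; only the set of answers at its end is reproduced. In the
  -- other direction the path to `δ₁` serves only to make its set of answers finite.
  · obtain ⟨δ, h, hk⟩ := reach_right γ (f γ₁) (finite_left γ₁)
    exact ⟨δ, h, equiv _ _ hk.symm⟩
  · obtain ⟨γ₁, h₁, hf⟩ := reach_left γ (k δ₁) (finite_right γ δ₁ h)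
    exact ⟨γ₁, h₁, equiv _ _ hf⟩

end Reachability

/-! ### Access relations attainable in GMS -/

namespace GMState

variable {U G M : Type u}

/-- The pairs of a user and a message to which the user has access. -/
def accessSet (γ : GMState U G M) : Set (U × M) := {x | γ.Access x.1 x.2}

/-- Every access is witnessed by a record and a transcript entry, and there are finitely many pairs
of these. -/
theorem accessSet_finite (γ : GMState U G M) : γ.accessSet.Finite := by
  refine ((γ.record ×ˢ γ.transcript).finite_toSet.image
    fun x => (x.1.1, x.2.2.1)).subset ?_
  rintro ⟨v, m⟩ ⟨g, -, tl, t, tu, hr, ht, -⟩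
  exact ⟨((v, g, tl, tu), (g, m, t)), by simp [hr, ht], rfl⟩

theorem accessSet_eq_empty {γ : GMState U G M} (h : γ.record = ∅) : γ.accessSet = ∅ := by
  ext ⟨v, m⟩
  simp [accessSet, Access, h]

/-- With `a = v` the command needs no administrator, so every record, open or closed, can be deleted
by its own user. -/
theorem record_sRemoveMember_self_subset (γ : GMState U G M) (v : U) (g : G) (s t : ℕ∞) :
    ((γ.sRemoveMember v v g).record : Set (U × G × ℕ∞ × ℕ∞)) ⊆
      (γ.record : Set (U × G × ℕ∞ × ℕ∞)) \ {(v, g, s, t)} := by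
  intro x hx
  rw [sRemoveMember, if_pos (.inr rfl)] at hx
  obtain ⟨hx, hne⟩ := Finset.mem_filter.1 hx
  refine ⟨hx, fun h => hne ?_⟩
  rw [Set.mem_singleton_iff.1 h]
  exact ⟨rfl, rfl⟩

/-- Creating a fresh group and posting a message to it gives its creator access to it. -/
theorem accessSet_post_createGroup (γ : GMState U G M) (v : U) (m : M) {g : G}
    (hg : g ∉ γ.groups) :
    ((γ.createGroup v g).post v g m).accessSet = insert (v, m) γ.accessSet := by
  -- Nothing old refers to the fresh group. So an old record cannot meet the new post, nor the new
  -- record an old post, and only the pair `(v, m)` is added.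
  have hr : ∀ w s t, (w, g, s, t) ∉ γ.record := fun w s t h => hg (γ.record_sub _ h)
  have ht : ∀ m t, (g, m, t) ∉ γ.transcript := fun m t h => hg (γ.transcript_sub _ h)
  have hm : ∃ t : ℕ∞, (v, g, t, ⊤) ∈ (γ.createGroup v g).record := ⟨0, by simp [createGroup]⟩
  ext ⟨w, n⟩
  simp only [accessSet, Access, post, dif_pos hm, Set.mem_ofPred_eq, Set.mem_insert_iff,
    Prod.mk.injEq]
  simp only [createGroup, Finset.mem_union, Finset.mem_singleton, Prod.mk.injEq]
  constructor
  · rintro ⟨g', -, tl, t, tu, hr' | ⟨rfl, rfl, -⟩, ht' | ⟨e, rfl, -⟩, h, h'⟩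
    · exact .inr ⟨g', γ.record_sub _ hr', tl, t, tu, hr', ht', h, h'⟩
    · exact absurd (e ▸ hr') (hr _ _ _)
    · exact absurd ht' (ht _ _)
    · exact .inl ⟨rfl, rfl⟩
  · rintro (⟨rfl, rfl⟩ | ⟨g', hg', tl, t, tu, hr', ht', h, h'⟩)
    -- The creator's record spans all times from `0` to `⊤`, hence covers the time of the post.
    · exact ⟨g, .inr rfl, 0, γ.now, ⊤, .inr ⟨rfl, rfl, rfl, rfl⟩, .inr ⟨rfl, rfl, rfl⟩,
        zero_le, le_top⟩
    · exact ⟨g', .inl hg', tl, t, tu, .inl hr', .inl ht', h, h'⟩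

end GMState

/-- In GMS, every finite access relation can be reached from every state. -/
theorem GMS_exists_reach_accessSet_eq {U G M : Type u} [Infinite G] (γ : GMState U G M)
    {T : Set (U × M)} (hT : T.Finite) :
    ∃ γ' : GMState U G M, (GMS U G M).Reach γ γ' ∧ γ'.accessSet = T := by
  refine Scheme.exists_reach_eq_of_finite (S := GMS U G M) GMState.accessSet (fun _ => True)
    (fun δ _ => ?_) (fun (δ : GMState U G M) _ ⟨v, m⟩ => ?_) γ trivial hT
  · obtain ⟨δ', h, -, h'⟩ := Scheme.exists_reach_eq_empty (S := GMS U G M)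
      (fun γ : GMState U G M => (γ.record : Set (U × G × ℕ∞ × ℕ∞))) (fun _ => True)
      (fun (δ : GMState U G M) _ ⟨v, g, s, t⟩ _ =>
        ⟨δ.sRemoveMember v v g,
          Scheme.Reach.exec (GMS U G M) δ .sRemoveMember (v, v, g), trivial,
          GMState.record_sRemoveMember_self_subset δ v g s t⟩)
      δ trivial (Finset.finite_toSet _)
    exact ⟨δ', h, trivial, GMState.accessSet_eq_empty (Finset.coe_eq_empty.1 h')⟩
  · obtain ⟨g, hg⟩ := Infinite.exists_notMem_finset δ.groups
    exact ⟨(δ.createGroup v g).post v g m,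
      (Scheme.Reach.exec (GMS U G M) δ .createGroup (v, g)).trans
        (Scheme.Reach.exec (GMS U G M) (δ.createGroup v g) .post (v, g, m)),
      trivial, GMState.accessSet_post_createGroup δ v m hg⟩

/-! ### Reachability in augmented schemes -/

theorem Scheme.augment_reach {S : Scheme.{u}} (A : AuxMachine S) {δ δ' : S.State}
    (a : A.State) (h : S.Reach δ δ') : (S.augment A).Reach (δ, a) (δ', a) := by
  induction h with
  | refl => exact .refl
  | tail _ hs ih =>
    obtain ⟨c, p, rfl⟩ := hs
    exact ih.tail ⟨.inl c, p, rfl⟩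

/-- Auxiliary commands leave the first component alone, so they can be dropped from a path. -/
theorem Scheme.reach_of_augment_reach {S : Scheme.{u}} {A : AuxMachine S}
    {δ δ' : (S.augment A).State} (h : (S.augment A).Reach δ δ') : S.Reach δ.1 δ'.1 := by
  induction h with
  | refl => exact .refl
  | tail _ hs ih =>
    obtain ⟨c | c, p, rfl⟩ := hs
    · exact ih.tail ⟨c, p, rfl⟩
    · exact ih

/-! ### DAC: read rights can be set freely -/

section DACMatching

variable {U G M O : Type u}

/-- The pairs of a subject and a message whose object the subject may read. -/
def dacReadSet (obj : M ↪ O) (A : U → O → Set Right.{u}) : Set (U × M) :=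
  {x | Right.read ∈ A x.1 (obj x.2)}

theorem dac_exec_apply_of_ne (c : DACCmd) (A : U → O → Set Right.{u}) (s t : U) (o : O)
    (i : Right.{u}) {v : U} {o' : O} (h : ¬ (v = t ∧ o' = o)) :
    ((DAC U O Right.own.{u}).exec c A (s, t, o, i) : U → O → Set Right.{u}) v o' = A v o' := by
  cases c
  · change (if Right.own ∈ A s o ∧ i ≠ Right.own then
      fun s' o' => if s' = t ∧ o' = o then A s' o' ∪ {i} else A s' o' else A) v o' = _
    split_ifs
    · exact if_neg h
    · rfl
  · change (if Right.own ∈ A s o ∧ i ≠ Right.own then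
      fun s' o' => if s' = t ∧ o' = o then A s' o' \ {i} else A s' o' else A) v o' = _
    split_ifs
    · exact if_neg h
    · rfl

theorem dac_exec_apply_self (c : DACCmd) (A : U → O → Set Right.{u}) (s t : U) (o : O)
    (h : Right.own ∈ A s o) :
    ((DAC U O Right.own.{u}).exec c A (s, t, o, Right.read) : U → O → Set Right.{u}) t o =
      match c with
      | .grant => A t o ∪ {Right.read}
      | .revoke => A t o \ {Right.read} := by
  cases c
  · change (if Right.own ∈ A s o ∧ Right.read ≠ Right.own then
      fun s' o' => if s' = t ∧ o' = o then A s' o' ∪ {Right.read} else A s' o' else A) t o = _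
    rw [if_pos ⟨h, by simp⟩]
    exact if_pos ⟨rfl, rfl⟩
  · change (if Right.own ∈ A s o ∧ Right.read ≠ Right.own then
      fun s' o' => if s' = t ∧ o' = o then A s' o' \ {Right.read} else A s' o' else A) t o = _
    rw [if_pos ⟨h, by simp⟩]
    exact if_pos ⟨rfl, rfl⟩

/-- Only `read` is granted or revoked, so universal ownership persists and such commands remain
effective. -/
theorem dac_exec_own (c : DACCmd) {A : U → O → Set Right.{u}} (h : ∀ v o, Right.own ∈ A v o)
    (s t : U) (o : O) (v : U) (o' : O) :
    Right.own ∈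
      ((DAC U O Right.own.{u}).exec c A (s, t, o, Right.read) : U → O → Set Right.{u}) v o' := by
  by_cases hvo : v = t ∧ o' = o
  · obtain ⟨rfl, rfl⟩ := hvo
    rw [dac_exec_apply_self c A s v o' (h s o')]
    cases c <;> simp [h]
  · rw [dac_exec_apply_of_ne c A s t o _ hvo]
    exact h v o'

/-- An access matrix need not be finite in any sense, so finiteness is followed along the path: a
command touches one entry, and by injectivity of `obj` this entry concerns at most one message. -/
theorem dac_reach_finite {A A' : U → O → Set Right.{u}} (obj : M ↪ O)
    (h : (DAC U O Right.own.{u}).Reach A A')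
    (hA : (dacReadSet obj A).Finite) : (dacReadSet obj A').Finite := by
  induction h with
  | refl => exact hA
  | @tail B _ _ hs ih =>
    obtain ⟨c, ⟨s, t, o, i⟩, rfl⟩ := hs
    have hf : {x : U × M | x.1 = t ∧ obj x.2 = o}.Finite := by
      refine Set.Subsingleton.finite ?_
      rintro ⟨v, m⟩ ⟨rfl, rfl⟩ ⟨v', m'⟩ ⟨rfl, h⟩
      exact Prod.ext rfl (obj.injective h.symm)
    refine (ih.union hf).subset ?_
    rintro ⟨v, m⟩ hx
    by_cases hvm : v = t ∧ obj m = o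
    · exact .inr hvm
    · exact .inl ((dac_exec_apply_of_ne c B s t o i hvm).subset hx)

theorem dac_exists_reach_readSet_eq (obj : M ↪ O) (A : U → O → Set Right.{u})
    (hown : ∀ v o, Right.own ∈ A v o) (hA : (dacReadSet obj A).Finite)
    {T : Set (U × M)} (hT : T.Finite) :
    ∃ A' : U → O → Set Right.{u},
      (DAC U O Right.own.{u}).Reach A A' ∧ dacReadSet obj A' = T := by
  have hne : ∀ {v w : U} {m n : M}, (w, n) ≠ (v, m) → ¬ (w = v ∧ obj n = obj m) := by
    rintro v w m n h ⟨rfl, h'⟩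
    exact h (by rw [obj.injective h'])
  refine Scheme.exists_reach_eq_of_finite (S := DAC U O Right.own.{u}) (dacReadSet obj)
    (fun A => (∀ v o, Right.own ∈ (A : U → O → Set Right.{u}) v o) ∧ (dacReadSet obj A).Finite)
    (fun A hA => ?_) (fun A hA ⟨v, m⟩ => ?_) A ⟨hown, hA⟩ hT
  · refine Scheme.exists_reach_eq_empty (S := DAC U O Right.own.{u}) (dacReadSet obj)
      (fun A => (∀ v o, Right.own ∈ (A : U → O → Set Right.{u}) v o) ∧ (dacReadSet obj A).Finite)
      (fun A hA ⟨v, m⟩ _ => ?_) A hA hA.2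
    -- Since every subject owns every object, `v` can act on its own entry.
    have hr := Scheme.Reach.exec (DAC U O Right.own.{u}) A .revoke (v, v, obj m, Right.read)
    refine ⟨_, hr, ⟨dac_exec_own _ hA.1 v v (obj m), dac_reach_finite obj hr hA.2⟩, ?_⟩
    rintro ⟨w, n⟩ hx
    by_cases h : (w, n) = (v, m)
    · obtain ⟨rfl, rfl⟩ := Prod.mk.inj h
      exact absurd rfl ((dac_exec_apply_self .revoke A w w (obj n) (hA.1 _ _)).subset hx).2
    · exact ⟨(dac_exec_apply_of_ne .revoke A v v (obj m) .read (hne h)).subset hx, h⟩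
  · have hr := Scheme.Reach.exec (DAC U O Right.own.{u}) A .grant (v, v, obj m, Right.read)
    refine ⟨_, hr, ⟨dac_exec_own _ hA.1 v v (obj m), dac_reach_finite obj hr hA.2⟩, ?_⟩
    ext ⟨w, n⟩
    by_cases h : (w, n) = (v, m)
    · obtain ⟨rfl, rfl⟩ := Prod.mk.inj h
      exact iff_of_true
        ((dac_exec_apply_self .grant A w w (obj n) (hA.1 _ _)).superset (.inr rfl)) (.inl rfl)
    · rw [Set.mem_insert_iff, or_iff_right h]
      exact Set.ext_iff.1 (dac_exec_apply_of_ne .grant A v v (obj m) .read (hne h)) Right.read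

theorem dacReadSet_dacMatrix (obj : M ↪ O) (γ : GMState U G M) :
    dacReadSet obj (dacMatrix obj γ) = γ.accessSet := by
  ext ⟨v, m⟩
  simp [dacReadSet, dacMatrix, GMState.accessSet]

theorem dacImpl_isStateMatching [Fintype U] [Infinite G] (obj : M ↪ O) :
    (dacImpl (U := U) (G := G) obj).IsStateMatching := by
  refine Implementation.isStateMatching_of_finite _ GMState.accessSet
    (fun δ => dacReadSet obj δ.1) (fun γ δ h _ x => Set.ext_iff.1 h x)
    GMState.accessSet_finite (fun γ δ h => ?_)
    (fun γ T hT => GMS_exists_reach_accessSet_eq γ hT) (fun γ T hT => ?_)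
  · refine dac_reach_finite obj (Scheme.reach_of_augment_reach h) ?_
    exact (dacReadSet_dacMatrix obj γ).symm ▸ GMState.accessSet_finite γ
  · obtain ⟨A, h, hA⟩ := dac_exists_reach_readSet_eq obj (dacMatrix obj γ)
      (fun _ _ => .inl rfl)
      ((dacReadSet_dacMatrix obj γ).symm ▸ GMState.accessSet_finite γ) hT
    exact ⟨(A, auxVState obj γ), Scheme.augment_reach (AuxV U G O Right.own.{u}) (auxVState obj γ) h, hA⟩

end DACMatching

/-! ### RBAC: access through message roles -/

section RBACMatching

variable {U G M P Ro : Type u}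

/-- The pairs of a user and a message to whose permission the user has access. -/
def rbacAccessSet (perm : M ↪ P) (ρ : RBACState U P Ro) : Set (U × M) :=
  {x | ∃ r ∈ ρ.roles, (x.1, r) ∈ ρ.ua ∧ (perm x.2, r) ∈ ρ.pa}

/-- Each access uses an element of the finite set `ua` and one of the finite set `pa`; injectivity
of `perm` carries finiteness back from permissions to messages. No invariant or path is needed,
unlike for DAC. -/
theorem rbacAccessSet_finite (perm : M ↪ P) (ρ : RBACState U P Ro) :
    (rbacAccessSet perm ρ).Finite := by
  refine Set.Finite.of_finite_image
    (f := fun x : U × M => (x.1, perm x.2)) ?_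
    (Function.Injective.injOn fun x y h => by
      obtain ⟨h₁, h₂⟩ := Prod.mk.inj h
      exact Prod.ext h₁ (perm.injective h₂))
  refine ((ρ.ua ×ˢ ρ.pa).finite_toSet.image fun x => (x.1.1, x.2.1)).subset ?_
  rintro _ ⟨⟨v, m⟩, ⟨r, -, h₁, h₂⟩, rfl⟩
  exact ⟨((v, r), (perm m, r)), by simp [h₁, h₂], rfl⟩

/-- Every user is an administrator, a permission is granted to the role of its message only, and
the role of a message is assigned only if it is active and has the permission. -/
structure RBACInvariant (perm : M ↪ P) (role : RoleName G M ↪ Ro) (ρ : RBACState U P Ro) :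
    Prop where
  admin : ∀ v, (v, role .admin) ∈ ρ.ua
  pa : ∀ x ∈ ρ.pa, ∃ m, x = (perm m, role (.msg m))
  ua : ∀ v m, (v, role (.msg m)) ∈ ρ.ua →
    role (.msg m) ∈ ρ.roles ∧ (perm m, role (.msg m)) ∈ ρ.pa

/-- The permission of `m` can come only from the role of `m`, by injectivity of `perm`, and an
assignment to that role is never idle. Changing accesses thus amounts to changing `ua`. -/
theorem RBACInvariant.mem_accessSet_iff {perm : M ↪ P} {role : RoleName G M ↪ Ro}
    {ρ : RBACState U P Ro} (h : RBACInvariant perm role ρ) (v : U) (m : M) :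
    (v, m) ∈ rbacAccessSet perm ρ ↔ (v, role (.msg m)) ∈ ρ.ua := by
  refine ⟨?_, fun h' => ⟨_, (h.ua v m h').1, h', (h.ua v m h').2⟩⟩
  rintro ⟨r, h₁, h₂, h₃⟩
  obtain ⟨n, hn⟩ := h.pa _ h₃
  obtain ⟨hm, rfl⟩ := Prod.mk.inj hn
  cases perm.injective hm
  exact h₂

theorem RBACInvariant.exists_reach_erase {perm : M ↪ P} {role : RoleName G M ↪ Ro}
    {ρ : RBACState U P Ro} (h : RBACInvariant perm role ρ) (v : U) (m : M) :
    ∃ ρ', (RBAC U P (role .admin)).Reach ρ ρ' ∧ RBACInvariant perm role ρ' ∧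
      rbacAccessSet perm ρ' ⊆ rbacAccessSet perm ρ \ {(v, m)} := by
  let ρ' : RBACState U P Ro := { ρ with ua := ρ.ua \ {(v, role (.msg m))} }
  have hr : (RBAC U P (role .admin)).Reach ρ ρ' := by
    have := Scheme.Reach.exec (RBAC U P (role .admin)) ρ .deassignUser (v, v, role (.msg m))
    simpa only [RBAC, h.admin, if_true] using this
  have h' : RBACInvariant perm role ρ' :=
    ⟨fun w => by simp [ρ', h.admin], h.pa, fun w n hw => h.ua w n (Finset.mem_sdiff.1 hw).1⟩
  refine ⟨ρ', hr, h', ?_⟩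
  rintro ⟨w, n⟩ hx
  rw [h'.mem_accessSet_iff] at hx
  obtain ⟨hx, hne⟩ := Finset.mem_sdiff.1 hx
  refine ⟨(h.mem_accessSet_iff w n).2 hx, fun e => hne ?_⟩
  cases e
  exact Finset.mem_singleton_self _

/-- The role of `m` may be inactive or lack its permission, so it is added and equipped before `v`
is assigned to it. This gives nobody else access: by the invariant, all users already assigned to it
had access before. -/
theorem RBACInvariant.exists_reach_insert {perm : M ↪ P} {role : RoleName G M ↪ Ro}
    {ρ : RBACState U P Ro} (h : RBACInvariant perm role ρ) (v : U) (m : M) :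
    ∃ ρ', (RBAC U P (role .admin)).Reach ρ ρ' ∧ RBACInvariant perm role ρ' ∧
      rbacAccessSet perm ρ' = insert (v, m) (rbacAccessSet perm ρ) := by
  let ρ₁ : RBACState U P Ro := { ρ with roles := ρ.roles ∪ {role (.msg m)} }
  let ρ₂ : RBACState U P Ro := { ρ₁ with pa := ρ₁.pa ∪ {(perm m, role (.msg m))} }
  let ρ₃ : RBACState U P Ro := { ρ₂ with ua := ρ₂.ua ∪ {(v, role (.msg m))} }
  have h₁ : (RBAC U P (role .admin)).Reach ρ ρ₁ := by
    have := Scheme.Reach.exec (RBAC U P (role .admin)) ρ .addRole (v, role (.msg m))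
    simpa only [RBAC, h.admin, if_true] using this
  have h₂ : (RBAC U P (role .admin)).Reach ρ₁ ρ₂ := by
    have := Scheme.Reach.exec (RBAC U P (role .admin)) ρ₁ .grantPermission
      (v, perm m, role (.msg m))
    simpa only [RBAC, show ρ₁.ua = ρ.ua from rfl, h.admin, if_true] using this
  have h₃ : (RBAC U P (role .admin)).Reach ρ₂ ρ₃ := by
    have := Scheme.Reach.exec (RBAC U P (role .admin)) ρ₂ .assignUser (v, v, role (.msg m))
    simpa only [RBAC, show ρ₂.ua = ρ.ua from rfl, h.admin, if_true] using this
  have h' : RBACInvariant perm role ρ₃ := by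
    refine ⟨fun w => Finset.mem_union_left _ (h.admin w), fun x hx => ?_, fun w n hw => ?_⟩
    · rcases Finset.mem_union.1 hx with hx | hx
      · exact h.pa x hx
      · exact ⟨m, Finset.mem_singleton.1 hx⟩
    · rcases Finset.mem_union.1 hw with hw | hw
      · exact ⟨Finset.mem_union_left _ (h.ua w n hw).1, Finset.mem_union_left _ (h.ua w n hw).2⟩
      · have e := role.injective (Prod.mk.inj (Finset.mem_singleton.1 hw)).2
        cases e
        exact ⟨Finset.mem_union_right _ (Finset.mem_singleton_self _),
          Finset.mem_union_right _ (Finset.mem_singleton_self _)⟩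
  refine ⟨ρ₃, (h₁.trans h₂).trans h₃, h', ?_⟩
  ext ⟨w, n⟩
  rw [Set.mem_insert_iff, h'.mem_accessSet_iff, h.mem_accessSet_iff]
  simp [ρ₃, ρ₂, ρ₁]

theorem rbacInvariant_rbacState [Fintype U] (perm : M ↪ P) (role : RoleName G M ↪ Ro)
    (γ : GMState U G M) : RBACInvariant perm role (rbacState perm role γ) := by
  refine ⟨fun v => by simp [rbacState], fun x hx => ?_, fun v m h => ?_⟩
  · obtain ⟨m, -, rfl⟩ := Finset.mem_image.1 hx
    exact ⟨m, rfl⟩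
  -- Since `role` is injective, an assignment to a message role comes only from the access part of
  -- `ua`, which ranges over posted messages.
  · have hm : m ∈ γ.posted := by
      simp only [rbacState, Finset.mem_union, Finset.mem_image, Finset.mem_filter,
        Finset.mem_product, Finset.mem_univ, true_and, Prod.mk.injEq,
        role.injective.eq_iff, reduceCtorEq, and_false, exists_false, or_false, false_or,
        RoleName.msg.injEq] at h
      obtain ⟨⟨w, n⟩, h, -, rfl⟩ := h
      exact h.1
    simp [rbacState, hm]

theorem rbacImpl_isStateMatching [Fintype U] [Infinite G] (perm : M ↪ P)
    (role : RoleName G M ↪ Ro) : (rbacImpl (U := U) perm role).IsStateMatching := by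
  refine Implementation.isStateMatching_of_finite _ GMState.accessSet
    (fun δ => rbacAccessSet perm δ.1) (fun γ δ h _ x => Set.ext_iff.1 h x)
    GMState.accessSet_finite (fun _ δ _ => rbacAccessSet_finite perm δ.1)
    (fun γ T hT => GMS_exists_reach_accessSet_eq γ hT) (fun γ T hT => ?_)
  obtain ⟨ρ, h, hρ⟩ := Scheme.exists_reach_eq_of_finite (S := RBAC U P (role .admin))
    (rbacAccessSet perm) (RBACInvariant perm role)
    (fun ρ hρ => Scheme.exists_reach_eq_empty (S := RBAC U P (role .admin))
      (rbacAccessSet perm) (RBACInvariant perm role)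
      (fun _ h x _ => RBACInvariant.exists_reach_erase h x.1 x.2) ρ hρ
      (rbacAccessSet_finite perm ρ))
    (fun _ h x => RBACInvariant.exists_reach_insert h x.1 x.2)
    (rbacState perm role γ) (rbacInvariant_rbacState perm role γ) hT
  exact ⟨(ρ, auxUState perm γ), Scheme.augment_reach (AuxU U G P (role .admin)) (auxUState perm γ) h, hρ⟩

end RBACMatching

end ACS

theorem mainTheorem3 (U G M P Ro O : Type u) [Fintype U] [Infinite G]
    (perm : M ↪ P) (role : ACS.RoleName G M ↪ Ro) (obj : M ↪ O) :
    -- the implementation in SD3-GM is state-matching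
    (ACS.sd3Impl U G M).IsStateMatching ∧
    -- and a lock-step bisimulation: the same command with the same parameters keeps the two
    -- states in correspondence, and corresponding states answer all queries in the same way
    (∀ (γ : (ACS.GMS U G M).State) (c : ACS.GMCmd) (p : c.Param U G M),
      (ACS.SD3GM U G M).exec c ((ACS.sd3Impl U G M).stateMap γ) p =
        (ACS.sd3Impl U G M).stateMap ((ACS.GMS U G M).exec c γ p)) ∧
    (∀ γ : (ACS.GMS U G M).State,
      (ACS.sd3Impl U G M).Equiv γ ((ACS.sd3Impl U G M).stateMap γ)) ∧
    -- the implementation in RBAC extended with the machine U is state-matching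
    (ACS.rbacImpl (U := U) perm role).IsStateMatching ∧
    -- the implementation in DAC extended with the machine V is state-matching
    (ACS.dacImpl (U := U) (G := G) obj).IsStateMatching := by
  exact ⟨ACS.sd3Impl_isStateMatching, ACS.sd3Impl_exec, ACS.sd3Impl_equiv,
    ACS.rbacImpl_isStateMatching perm role, ACS.dacImpl_isStateMatching obj⟩
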